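/- Let $n\ge 1$. Let $B^n=\{x\in\mathbb R^n:\ |x|<1\}$ carry the Riemannian metric $g_{B^n}$ with matrix $$G_{B^n}(x)_{ij}=\delta_{ij}+\frac{x_ix_j}{1-|x|^2},$$ and let $S^n=\{x\in\mathbb R^n:\ x_i>0 \text{ for all } i,\ \sum_{k} x_k<1\}$ carry the Riemannian metric $g_{S^n}$ with matrix $$G_{S^n}(x)_{ij}=\frac{\delta_{ij}}{x_i}+\frac1{1-\sum_k x_k}$$ (the Baran metrics of the ball and of the simplex). For a Riemannian manifold $(M,g)$ and $u\in C^\infty(M)$ real-valued, put $\|u\|_{1,2}=\left(\int_M|u|^2\,d\mathrm{Vol}_g\right)^{1/2}+\left(\int_M|\mathrm{grad}\,u|_g^2\,d\mathrm{Vol}_g\right)^{1/2}$. The space $H^1(M,g)$ is the closure with respect to $\|\cdot\|_{1,2}$, in $L^2(M,\mathrm{Vol}_g)$, of $\{u\in C^\infty(M):\|u\|_{1,2}<\infty\}$, and $H^1_0(M,g)$ is the closure of $C^\infty_c(M)$ in the same norm; that is, they consist of the $L^2$-limits of the $\|\cdot\|_{1,2}$-Cauchy sequences in the respective class. Let $M\cup\Gamma$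 be the metric completion of $M$ with respect to the Riemannian distance, with boundary $\Gamma=(M\cup\Gamma)\setminus M$. For an open set $O\subseteq M\cup\Gamma$ let $\mathrm{Cap}(O)$ be the infimum of $\|u\|_{1,2}$ over all continuous, compactly supported functions $u$ on $M\cup\Gamma$ that are smooth on $M$ and satisfy $0\le u\le 1$ and $u\equiv1$ on $O$. For $A\subseteq M\cup\Gamma$ let $\mathrm{Cap}(A)=\inf\{\mathrm{Cap}(O): O\supseteq A \text{ open}\}$. The manifold $M$ is said to have almost polar boundary if $\mathrm{Cap}(\Gamma)=0$. (If $O\supseteq\Gamma$, such a $u$ is constant near $\Gamma$, hence smooth up to the boundary.) Then neither $(B^n,g_{B^n})$ nor $(S^n,g_{S^n})$ has almost polar boundary, and $$H^1(B^n,g_{B^n})\neq H^1_0(B^n,g_{B^n}),\qquad H^1(S^n,g_{S^n})\neq H^1_0(S^n,g_{S^n}).$$ -/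

import Mathlib

open Set Filter Topology MeasureTheory
open scoped ENNReal NNReal ContDiff

noncomputable section

/-- An open subset of `ℝⁿ` with a smooth Riemannian metric, given by its matrix in the standard
coordinates. -/
structure RiemannianDomain (n : ℕ) where
  carrier : Set (EuclideanSpace ℝ (Fin n))
  metric : EuclideanSpace ℝ (Fin n) → Matrix (Fin n) (Fin n) ℝ
  isOpen_carrier : IsOpen carrier
  posDef_metric : ∀ x ∈ carrier, (metric x).PosDef
  smooth_metric : ∀ i j, ContDiffOn ℝ ∞ (fun x => metric x i j) carrier

namespace RiemannianDomain

variable {n : ℕ} (M : RiemannianDomain n)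

/-- `⟨v, v⟩_{g(x)}` -/
def sqNorm (x v : EuclideanSpace ℝ (Fin n)) : ℝ :=
  ∑ i, ∑ j, M.metric x i j * v i * v j

/-- The Riemannian volume `√(det g) dx` on the domain. -/
def vol : Measure (EuclideanSpace ℝ (Fin n)) :=
  (volume.restrict M.carrier).withDensity
    (fun x => ENNReal.ofReal (Real.sqrt (M.metric x).det))

/-- `(grad u)_i = ∑ⱼ g^{ij} ∂ⱼu` -/
def grad (u : EuclideanSpace ℝ (Fin n) → ℝ) (x : EuclideanSpace ℝ (Fin n)) :
    EuclideanSpace ℝ (Fin n) :=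
  WithLp.toLp 2 (fun i => ∑ j, (M.metric x)⁻¹ i j * fderiv ℝ u x (EuclideanSpace.single j 1))

/-- `‖u‖_{1,2} = (∫ |u|² dVol_g)^{1/2} + (∫ |grad u|²_g dVol_g)^{1/2}`, possibly infinite. -/
def norm12 (u : EuclideanSpace ℝ (Fin n) → ℝ) : ℝ≥0∞ :=
  (∫⁻ x, ENNReal.ofReal (u x ^ 2) ∂M.vol) ^ (1 / 2 : ℝ) +
    (∫⁻ x, ENNReal.ofReal (M.sqNorm x (M.grad u x)) ∂M.vol) ^ (1 / 2 : ℝ)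

/-- `C^∞_{1,2}(M)`: smooth functions on the domain with finite norm. Functions on the domain are
represented by functions on `ℝⁿ` with irrelevant values outside of it. -/
def smooth12 : Set (EuclideanSpace ℝ (Fin n) → ℝ) :=
  {u | ContDiffOn ℝ ∞ u M.carrier ∧ M.norm12 u < ⊤}

/-- `C^∞_c(M)` -/
def smoothCompact : Set (EuclideanSpace ℝ (Fin n) → ℝ) :=
  {u | ContDiff ℝ ∞ u ∧ HasCompactSupport u ∧ tsupport u ⊆ M.carrier}

/-- The closure in `‖·‖_{1,2}` of a class `D` of functions, realised in `L²(M, Vol_g)`: the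
`L²`-limits of the sequences in `D` that are Cauchy for `‖·‖_{1,2}`. -/
def sobolevClosure (D : Set (EuclideanSpace ℝ (Fin n) → ℝ)) : Set (Lp ℝ 2 M.vol) :=
  {f | ∃ u : ℕ → EuclideanSpace ℝ (Fin n) → ℝ,
    (∀ k, u k ∈ D) ∧
    (∀ ε : ℝ≥0∞, 0 < ε → ∃ N, ∀ j ≥ N, ∀ k ≥ N, M.norm12 (u j - u k) < ε) ∧
    Tendsto (fun k => eLpNorm (u k - ⇑f) 2 M.vol) atTop (𝓝 0)}

/-- The Sobolev space `H¹(M,g)`. -/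
def H1 : Set (Lp ℝ 2 M.vol) := M.sobolevClosure M.smooth12

/-- The Sobolev space `H¹₀(M,g)`. -/
def H10 : Set (Lp ℝ 2 M.vol) := M.sobolevClosure M.smoothCompact

/-- The Riemannian length of a Lipschitz curve parametrised by `[0,1]`. -/
def length (γ : ℝ → EuclideanSpace ℝ (Fin n)) : ℝ≥0∞ :=
  ∫⁻ t in Icc (0 : ℝ) 1, ENNReal.ofReal (Real.sqrt (M.sqNorm (γ t) (deriv γ t)))

/-- `γ` restricts to a Lipschitz curve `[0,1] → M` from `x` to `y`. -/
structure IsCurve (γ : ℝ → EuclideanSpace ℝ (Fin n)) (x y : EuclideanSpace ℝ (Fin n)) : Prop where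
  lipschitz : ∃ K : ℝ≥0, LipschitzOnWith K γ (Icc 0 1)
  mapsTo : MapsTo γ (Icc 0 1) M.carrier
  source : γ 0 = x
  target : γ 1 = y

/-- The Riemannian distance: the infimum of the lengths of the Lipschitz curves in `M`. -/
def riemDist (x y : EuclideanSpace ℝ (Fin n)) : ℝ≥0∞ :=
  ⨅ (γ : ℝ → EuclideanSpace ℝ (Fin n)) (_ : M.IsCurve γ x y), M.length γ

lemma sqNorm_smul (x v : EuclideanSpace ℝ (Fin n)) (c : ℝ) :
    M.sqNorm x (c • v) = c ^ 2 * M.sqNorm x v := by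
  simp only [sqNorm, Finset.mul_sum, PiLp.smul_apply, smul_eq_mul]
  refine Finset.sum_congr rfl fun i _ => Finset.sum_congr rfl fun j _ => ?_
  ring

lemma riemDist_self {x : EuclideanSpace ℝ (Fin n)} (hx : x ∈ M.carrier) :
    M.riemDist x x = 0 := by
  rw [← nonpos_iff_eq_zero]
  have h : M.IsCurve (fun _ => x) x x :=
    ⟨⟨0, LipschitzWith.lipschitzOnWith (LipschitzWith.const x)⟩, fun _ _ => hx, rfl, rfl⟩
  refine (iInf₂_le (fun _ => x) h).trans ?_
  simp [length, sqNorm]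

/-- The length integral of an affinely reparametrised curve. -/
lemma lintegral_affine (γ : ℝ → EuclideanSpace ℝ (Fin n)) (a b : ℝ) (ha : a ≠ 0) (s : Set ℝ)
    (hs : MeasurableSet s) :
    ∫⁻ t in s, ENNReal.ofReal (Real.sqrt (M.sqNorm (γ (a * t + b))
        (deriv (fun t => γ (a * t + b)) t))) =
      ∫⁻ t in (fun t => a * t + b) '' s,
        ENNReal.ofReal (Real.sqrt (M.sqNorm (γ t) (deriv γ t))) := by
  have hd : ∀ t ∈ s, HasDerivWithinAt (fun t => a * t + b) a s t := fun t _ => by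
    simpa using (((hasDerivAt_id t).const_mul a).add_const b).hasDerivWithinAt
  have hinj : InjOn (fun t => a * t + b) s := fun t _ t' _ h => by
    simpa [ha] using h
  rw [lintegral_image_eq_lintegral_abs_deriv_mul hs hd hinj]
  refine lintegral_congr fun t => ?_
  have h1 : deriv (fun t => γ (a * t + b)) t = a • deriv γ (a * t + b) := by
    have := deriv_comp_mul_left a (fun t => γ (t + b)) t
    rw [this, deriv_comp_add_const]
  rw [h1, sqNorm_smul, Real.sqrt_mul (sq_nonneg a), Real.sqrt_sq_eq_abs,
    ENNReal.ofReal_mul (abs_nonneg a)]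

lemma riemDist_comm_le (x y : EuclideanSpace ℝ (Fin n)) : M.riemDist x y ≤ M.riemDist y x := by
  refine le_iInf₂ fun γ hγ => ?_
  have hm : MapsTo (fun t : ℝ => -1 * t + 1) (Icc 0 1) (Icc 0 1) := fun t ht => by
    constructor <;> linarith [ht.1, ht.2]
  have h : M.IsCurve (fun t => γ (-1 * t + 1)) x y := by
    obtain ⟨K, hK⟩ := hγ.lipschitz
    refine ⟨⟨K, fun s hs t ht => ?_⟩, fun t ht => hγ.mapsTo (hm ht), ?_, ?_⟩
    · refine (hK (hm hs) (hm ht)).trans (le_of_eq ?_)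
      congr 1
      rw [edist_dist, edist_dist, Real.dist_eq, Real.dist_eq, abs_sub_comm s t]
      congr 2
      ring
    · simpa using hγ.target
    · simpa using hγ.source
  refine (iInf₂_le (fun t => γ (-1 * t + 1)) h).trans (le_of_eq ?_)
  unfold length
  rw [lintegral_affine M γ (-1) 1 (by norm_num) _ measurableSet_Icc]
  congr 2
  ext t
  constructor
  · rintro ⟨s, hs, rfl⟩
    exact hm hs
  · intro ht
    exact ⟨-1 * t + 1, hm ht, by ring⟩

lemma riemDist_triangle (x y z : EuclideanSpace ℝ (Fin n)) :
    M.riemDist x z ≤ M.riemDist x y + M.riemDist y z := by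
  refine ENNReal.le_iInf₂_add_iInf₂ fun γ hγ δ hδ => ?_
  set η : ℝ → EuclideanSpace ℝ (Fin n) := fun t =>
    if t ≤ 1 / 2 then γ (2 * t + 0) else δ (2 * t + -1) with hη
  have hη1 : ∀ t, t ≤ 1 / 2 → η t = γ (2 * t + 0) := fun t ht => if_pos ht
  have hη2 : ∀ t, 1 / 2 ≤ t → η t = δ (2 * t + -1) := fun t ht => by
    rcases ht.eq_or_lt with h | h
    · rw [hη1 t h.ge, ← h]
      norm_num [hγ.target, hδ.source]
    · exact if_neg (not_le.mpr h)
  have hm1 : ∀ t : ℝ, 0 ≤ t → t ≤ 1 / 2 → 2 * t + 0 ∈ Icc (0 : ℝ) 1 := fun t h h' => by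
    constructor <;> linarith
  have hm2 : ∀ t : ℝ, 1 / 2 ≤ t → t ≤ 1 → 2 * t + -1 ∈ Icc (0 : ℝ) 1 := fun t h h' => by
    constructor <;> linarith
  have hcurve : M.IsCurve η x z := by
    refine ⟨?_, fun t ht => ?_, ?_, ?_⟩
    · obtain ⟨K, hK⟩ := hγ.lipschitz
      obtain ⟨L, hL⟩ := hδ.lipschitz
      have key : ∀ s ∈ Icc (0 : ℝ) 1, ∀ t ∈ Icc (0 : ℝ) 1, s ≤ t →
          dist (η s) (η t) ≤ ((2 * (K + L) : ℝ≥0) : ℝ) * dist s t := by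
        intro s hs t ht hst
        have hK0 : (0 : ℝ) ≤ K := K.2
        have hL0 : (0 : ℝ) ≤ L := L.2
        rw [Real.dist_eq, abs_sub_comm, abs_of_nonneg (by linarith : 0 ≤ t - s)]
        push_cast
        have hA : ∀ s t : ℝ, 0 ≤ s → s ≤ t → t ≤ 1 / 2 →
            dist (η s) (η t) ≤ K * (2 * (t - s)) := by
          intro s t h0 h1 h2
          rw [hη1 s (by linarith), hη1 t h2]
          refine (hK.dist_le_mul _ (hm1 s h0 (by linarith)) _
            (hm1 t (by linarith) h2)).trans (le_of_eq ?_)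
          rw [Real.dist_eq, abs_sub_comm, abs_of_nonneg (by linarith)]
          ring
        have hB : ∀ s t : ℝ, 1 / 2 ≤ s → s ≤ t → t ≤ 1 →
            dist (η s) (η t) ≤ L * (2 * (t - s)) := by
          intro s t h0 h1 h2
          rw [hη2 s h0, hη2 t (by linarith)]
          refine (hL.dist_le_mul _ (hm2 s h0 (by linarith)) _
            (hm2 t (by linarith) h2)).trans (le_of_eq ?_)
          rw [Real.dist_eq, abs_sub_comm, abs_of_nonneg (by linarith)]
          ring
        rcases le_total t (1 / 2) with h | h
        · have := hA s t hs.1 hst h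
          nlinarith [mul_nonneg hL0 (sub_nonneg.mpr hst)]
        · rcases le_total (1 / 2) s with h' | h'
          · have := hB s t h' hst ht.2
            nlinarith [mul_nonneg hK0 (sub_nonneg.mpr hst)]
          · have h1 := hA s (1 / 2) hs.1 h' le_rfl
            have h2 := hB (1 / 2) t le_rfl h ht.2
            have h3 := dist_triangle (η s) (η (1 / 2)) (η t)
            nlinarith [mul_nonneg hL0 (sub_nonneg.mpr h'), mul_nonneg hK0 (sub_nonneg.mpr h)]
      refine ⟨2 * (K + L), LipschitzOnWith.of_dist_le_mul fun s hs t ht => ?_⟩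
      rcases le_total s t with h | h
      · exact key s hs t ht h
      · rw [dist_comm (η s), dist_comm s]
        exact key t ht s hs h
    · rcases le_total t (1 / 2) with h | h
      · rw [hη1 t h]
        exact hγ.mapsTo (hm1 t ht.1 h)
      · rw [hη2 t h]
        exact hδ.mapsTo (hm2 t h ht.2)
    · rw [hη1 0 (by norm_num)]
      simpa using hγ.source
    · rw [hη2 1 (by norm_num)]
      norm_num [hδ.target]
  refine (iInf₂_le η hcurve).trans ?_
  have e1 : ∫⁻ t in Ioo (0 : ℝ) (1 / 2),
        ENNReal.ofReal (Real.sqrt (M.sqNorm (η t) (deriv η t))) ≤ M.length γ := by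
    have : ∫⁻ t in Ioo (0 : ℝ) (1 / 2),
        ENNReal.ofReal (Real.sqrt (M.sqNorm (η t) (deriv η t))) =
        ∫⁻ t in Ioo (0 : ℝ) (1 / 2), ENNReal.ofReal (Real.sqrt (M.sqNorm (γ (2 * t + 0))
          (deriv (fun t => γ (2 * t + 0)) t))) := by
      refine setLIntegral_congr_fun measurableSet_Ioo fun t ht => ?_
      have hev : η =ᶠ[𝓝 t] fun t => γ (2 * t + 0) := by
        filter_upwards [Iio_mem_nhds ht.2] with s hs
        exact hη1 s (le_of_lt hs)
      simp only [hev.deriv_eq, hη1 t ht.2.le]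
    rw [this, lintegral_affine M γ 2 0 (by norm_num) _ measurableSet_Ioo]
    refine lintegral_mono_set ?_
    rintro _ ⟨t, ht, rfl⟩
    exact hm1 t ht.1.le ht.2.le
  have e2 : ∫⁻ t in Ioo (1 / 2 : ℝ) 1,
        ENNReal.ofReal (Real.sqrt (M.sqNorm (η t) (deriv η t))) ≤ M.length δ := by
    have : ∫⁻ t in Ioo (1 / 2 : ℝ) 1,
        ENNReal.ofReal (Real.sqrt (M.sqNorm (η t) (deriv η t))) =
        ∫⁻ t in Ioo (1 / 2 : ℝ) 1, ENNReal.ofReal (Real.sqrt (M.sqNorm (δ (2 * t + -1))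
          (deriv (fun t => δ (2 * t + -1)) t))) := by
      refine setLIntegral_congr_fun measurableSet_Ioo fun t ht => ?_
      have hev : η =ᶠ[𝓝 t] fun t => δ (2 * t + -1) := by
        filter_upwards [Ioi_mem_nhds ht.1] with s hs
        exact hη2 s (le_of_lt hs)
      simp only [hev.deriv_eq, hη2 t ht.1.le]
    rw [this, lintegral_affine M δ 2 (-1) (by norm_num) _ measurableSet_Ioo]
    refine lintegral_mono_set ?_
    rintro _ ⟨t, ht, rfl⟩
    exact hm2 t ht.1.le ht.2.le
  refine le_trans ?_ (add_le_add e1 e2)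
  have hsub : Icc (0 : ℝ) 1 ≤ᵐ[volume] (Ioo (0 : ℝ) (1 / 2) ∪ Ioo (1 / 2 : ℝ) 1 : Set ℝ) := by
    have hfin : ({0, 1 / 2, 1} : Set ℝ)ᶜ ∈ ae (volume : Measure ℝ) :=
      compl_mem_ae_iff.mpr ((Set.toFinite _).measure_zero _)
    filter_upwards [hfin] with t ht ht'
    simp only [mem_compl_iff, mem_insert_iff, mem_singleton_iff, not_or] at ht
    rcases lt_or_gt_of_ne ht.2.1 with h | h
    · exact Or.inl ⟨lt_of_le_of_ne ht'.1 (Ne.symm ht.1), h⟩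
    · exact Or.inr ⟨h, lt_of_le_of_ne ht'.2 ht.2.2⟩
  exact (lintegral_mono' (Measure.restrict_mono_ae hsub) le_rfl).trans (lintegral_union_le _ _ _)

/-- The points of the domain, as a space with the Riemannian distance. -/
def Point : Type := {x : EuclideanSpace ℝ (Fin n) // x ∈ M.carrier}

instance : PseudoEMetricSpace M.Point where
  edist p q := M.riemDist p.1 q.1
  edist_self p := M.riemDist_self p.2
  edist_comm p q := le_antisymm (M.riemDist_comm_le _ _) (M.riemDist_comm_le _ _)
  edist_triangle p q r := M.riemDist_triangle _ _ _

/-- `M ∪ Γ`, the metric completion of `(M, d_g)`. -/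
abbrev Completed : Type := UniformSpace.Completion M.Point

/-- The boundary `Γ`: the points of the metric completion that are not in `M`. -/
def boundary : Set M.Completed := (Set.range ((↑) : M.Point → M.Completed))ᶜ

/-- `v` is a continuous function with compact support on `M ∪ Γ`, which restricts to the smooth
function `u` on `M`. -/
structure IsTest (u : EuclideanSpace ℝ (Fin n) → ℝ) (v : M.Completed → ℝ) : Prop where
  smooth : ContDiffOn ℝ ∞ u M.carrier
  continuous : Continuous v
  hasCompactSupport : HasCompactSupport v
  eq_restrict : ∀ p : M.Point, v (p : M.Completed) = u p.1

/-- The capacity of an open `O ⊆ M ∪ Γ`: the infimum of `‖u‖_{1,2}` over the test functions `u`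
with `0 ≤ u ≤ 1` and `u = 1` on `O`. If `O` contains `Γ` (the only case used for the capacity of
`Γ`), such a `u` is constant near `Γ`, so that it is smooth up to the boundary for every smooth
structure that `M ∪ Γ` may carry: these are the functions in `C^∞_c(M ∪ Γ)` with `0 ≤ u ≤ 1` and
`u = 1` on `O`. -/
def capOpen (O : Set M.Completed) : ℝ≥0∞ :=
  ⨅ (u : EuclideanSpace ℝ (Fin n) → ℝ) (v : M.Completed → ℝ)
    (_ : M.IsTest u v ∧ (∀ p, 0 ≤ v p ∧ v p ≤ 1) ∧ ∀ p ∈ O, v p = 1), M.norm12 u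

/-- The outer capacity of a subset of `M ∪ Γ`. -/
def cap (A : Set M.Completed) : ℝ≥0∞ :=
  ⨅ (O : Set M.Completed) (_ : IsOpen O ∧ A ⊆ O), M.capOpen O

/-- `M` is a manifold with almost polar boundary: the boundary `Γ` of its metric completion
`M ∪ Γ` has zero outer capacity. -/
def HasAlmostPolarBoundary : Prop := M.cap M.boundary = 0

end RiemannianDomain

/-- The matrix `δ_{ij} + x_i x_j / (1 - |x|²)`. -/
def ballMatrix (n : ℕ) (x : EuclideanSpace ℝ (Fin n)) : Matrix (Fin n) (Fin n) ℝ :=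
  Matrix.of fun i j => (if i = j then 1 else 0) + x i * x j / (1 - ∑ k, x k ^ 2)

/-- The matrix `δ_{ij} / x_i + 1 / (1 - ∑ x_k)`. -/
def simplexMatrix (n : ℕ) (x : EuclideanSpace ℝ (Fin n)) : Matrix (Fin n) (Fin n) ℝ :=
  Matrix.of fun i j => (if i = j then (x i)⁻¹ else 0) + 1 / (1 - ∑ k, x k)

/-- The open unit ball of `ℝⁿ` with its Baran metric. -/
def baranBall (n : ℕ) : RiemannianDomain n where
  carrier := {x | ∑ k, x k ^ 2 < 1}
  metric := ballMatrix n
  isOpen_carrier := isOpen_lt (by fun_prop) continuous_const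
  posDef_metric := fun x hx => by
    have hx' : 0 < 1 - ∑ k, x k ^ 2 := sub_pos.mpr hx
    have h : ballMatrix n x =
        1 + (1 - ∑ k, x k ^ 2)⁻¹ • Matrix.vecMulVec (fun i => x i) (star fun i => x i) := by
      ext i j
      simp only [ballMatrix, Matrix.of_apply, Matrix.add_apply, Matrix.one_apply,
        Matrix.smul_apply, Matrix.vecMulVec_apply, smul_eq_mul, star_trivial]
      ring
    rw [h]
    exact Matrix.PosDef.one.add_posSemidef
      ((Matrix.posSemidef_vecMulVec_self_star _).smul (inv_pos.mpr hx').le)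
  smooth_metric := fun i j => by
    simp only [ballMatrix, Matrix.of_apply]
    refine contDiffOn_const.add (ContDiffOn.div (by fun_prop) (by fun_prop) fun x hx => ?_)
    exact (sub_pos.mpr hx).ne'

/-- The open unit simplex of `ℝⁿ` with its Baran metric. -/
def baranSimplex (n : ℕ) : RiemannianDomain n where
  carrier := {x | (∀ k, 0 < x k) ∧ ∑ k, x k < 1}
  metric := simplexMatrix n
  isOpen_carrier := by
    have : {x : EuclideanSpace ℝ (Fin n) | (∀ k, 0 < x k) ∧ ∑ k, x k < 1} =
        (⋂ k, {x | 0 < x k}) ∩ {x | ∑ k, x k < 1} := by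
      ext x
      simp
    rw [this]
    exact (isOpen_iInter_of_finite fun k => isOpen_lt continuous_const (by fun_prop)).inter
      (isOpen_lt (by fun_prop) continuous_const)
  posDef_metric := fun x hx => by
    have hx' : 0 < 1 - ∑ k, x k := sub_pos.mpr hx.2
    have h : simplexMatrix n x = Matrix.diagonal (fun i => (x i)⁻¹) +
        (1 - ∑ k, x k)⁻¹ • Matrix.vecMulVec (fun _ => (1 : ℝ)) (star fun _ => (1 : ℝ)) := by
      ext i j
      simp only [simplexMatrix, Matrix.of_apply, Matrix.add_apply, Matrix.diagonal_apply,
        Matrix.smul_apply, Matrix.vecMulVec_apply, smul_eq_mul, star_trivial]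
      ring
    rw [h]
    exact (Matrix.PosDef.diagonal fun i => inv_pos.mpr (hx.1 i)).add_posSemidef
      ((Matrix.posSemidef_vecMulVec_self_star _).smul (inv_pos.mpr hx').le)
  smooth_metric := fun i j => by
    simp only [simplexMatrix, Matrix.of_apply]
    refine ContDiffOn.add ?_ (ContDiffOn.div (by fun_prop) (by fun_prop) fun x hx => ?_)
    · split_ifs
      · exact ContDiffOn.inv (by fun_prop) fun x hx => (hx.1 i).ne'
      · exact contDiffOn_const
    · exact (sub_pos.mpr hx.2).ne'

end

/-! The field `x_i ∂_i` has Euclidean divergence 1. Hence if `r` equals 1 near the boundary of a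
bounded domain, the integral of `∂_i (x_i r) = r + x_i ∂_i r` against Lebesgue measure is the
Euclidean volume `|M|`, whatever `r` does inside (`volume_carrier_le`). For both Baran metrics `det
g ≥ 1` and `x_i² g_ii ≤ det g`, and the Riemannian volume is finite, so Cauchy–Schwarz bounds this
integral by `Vol(M)^{1/2} ‖r‖_{1,2}`. Functions that are 1 near the boundary therefore have norm at
least `|M| / Vol(M)^{1/2} > 0`.

For the capacity, a test function that is 1 on a neighbourhood of `Γ` must be shown to be 1 near the
Euclidean boundary. This holds because the Riemannian distance is at most a constant times the
square root of the Euclidean one, and at least the Euclidean one: a sequence tending to a Euclidean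
boundary point is Riemannian Cauchy and has no limit in `M` (`exists_tendsto_boundary`).

For the Sobolev spaces, the constant 1 lies in `H¹`. If compactly supported `u_k` were Cauchy and
tended to 1 in `L²`, fix `N` with `u_k - u_N` small for all `k ≥ N` and cut off the support of
`u_N`. The flux identity for `(1 - φ)(1 - u_k)` bounds `|M|` by a multiple of `‖u_k - 1‖_{L²}`,
which tends to 0, plus at most `|M|/2`.

`HasReachableBoundary` collects what this needs; it is then checked for the ball and the simplex. -/

/-! ### One-variable estimates for the lengths of segments. -/

lemma integrableOn_inv_sqrt : IntegrableOn (fun t : ℝ => (√t)⁻¹) (Ioo 0 1) := by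
  have h := (intervalIntegral.intervalIntegrable_rpow' (a := 0) (b := 1)
    (by norm_num : (-1 : ℝ) < -(1 / 2))).1
  refine (h.mono_set Ioo_subset_Ioc_self).congr_fun (fun t ht => ?_) measurableSet_Ioo
  dsimp only
  rw [Real.rpow_neg ht.1.le, Real.sqrt_eq_rpow]

lemma integrableOn_inv_sqrt_one_sub : IntegrableOn (fun t : ℝ => (√(1 - t))⁻¹) (Ioo 0 1) := by
  have h := (intervalIntegral.intervalIntegrable_rpow' (a := 0) (b := 1)
    (by norm_num : (-1 : ℝ) < -(1 / 2))).comp_sub_left 1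
  simp only [sub_zero, sub_self] at h
  refine (h.2.mono_set Ioo_subset_Ioc_self).congr_fun (fun t ht => ?_) measurableSet_Ioo
  dsimp only
  rw [Real.rpow_neg (by linarith [ht.2]), Real.sqrt_eq_rpow]

lemma Real.sqrt_add_le_sqrt_add_sqrt {a b : ℝ} (ha : 0 ≤ a) (hb : 0 ≤ b) :
    √(a + b) ≤ √a + √b :=
  Real.sqrt_le_iff.mpr ⟨by positivity, by
    nlinarith [Real.sq_sqrt ha, Real.sq_sqrt hb,
      mul_nonneg (Real.sqrt_nonneg a) (Real.sqrt_nonneg b)]⟩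

lemma Real.sqrt_inv_mul_one_sub_le {t : ℝ} (ht : t ∈ Ioo (0 : ℝ) 1) :
    √((t * (1 - t))⁻¹) ≤ (√t)⁻¹ + (√(1 - t))⁻¹ := by
  have h0 : 0 < t := ht.1
  have h1 : 0 < 1 - t := sub_pos.mpr ht.2
  have e : (t * (1 - t))⁻¹ = t⁻¹ + (1 - t)⁻¹ := by
    field_simp
    ring
  rw [e, ← Real.sqrt_inv, ← Real.sqrt_inv]
  exact Real.sqrt_add_le_sqrt_add_sqrt (inv_pos.mpr h0).le (inv_pos.mpr h1).le

lemma lintegral_sqrt_inv_mul_one_sub_lt_top :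
    ∫⁻ t in Icc (0 : ℝ) 1, ENNReal.ofReal √((t * (1 - t))⁻¹) < ⊤ := by
  rw [← setLIntegral_congr Ioo_ae_eq_Icc]
  refine lt_of_le_of_lt (setLIntegral_mono' measurableSet_Ioo fun t ht =>
    ENNReal.ofReal_le_ofReal (Real.sqrt_inv_mul_one_sub_le ht)) ?_
  exact (integrableOn_inv_sqrt.add integrableOn_inv_sqrt_one_sub).lintegral_lt_top

/-- On a segment between nonnegative reals, the interpolation dominates the increment. -/
lemma mul_abs_sub_le_interpolation {a b t : ℝ} (ha : 0 ≤ a) (hb : 0 ≤ b)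
    (ht : t ∈ Ioo (0 : ℝ) 1) : t * (1 - t) * |b - a| ≤ a + t * (b - a) := by
  have h0 : 0 < t := ht.1
  have h1 : 0 < 1 - t := sub_pos.mpr ht.2
  -- The interpolation is at least `t (b - a)` if `b ≥ a`, and at least `(1 - t)(a - b)` otherwise.
  rcases abs_cases (b - a) with h | h <;> rw [h.1] <;>
  nlinarith [mul_nonneg h0.le hb, mul_nonneg h1.le ha, mul_nonneg (mul_nonneg h0.le h0.le) hb,
    mul_nonneg (mul_nonneg h1.le h1.le) ha, mul_nonneg (mul_nonneg h0.le h0.le) ha,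
    mul_nonneg (mul_nonneg h0.le h1.le) ha, mul_nonneg (mul_nonneg h1.le h1.le) hb,
    mul_nonneg (mul_nonneg h0.le h1.le) hb]

/-! ### Comparison of the Riemannian and Euclidean distances. -/

namespace RiemannianDomain

variable {n : ℕ} {M : RiemannianDomain n}

/-- A bounded convex domain whose metric dominates the Euclidean one, is at most inversely
proportional to the distance from the boundary along segments, has finite volume, and for which
the field `x_i ∂_i` is bounded relative to the volume density. -/
structure HasReachableBoundary (M : RiemannianDomain n) (i : Fin n) : Prop where
  convex : Convex ℝ M.carrier
  isBounded : Bornology.IsBounded M.carrier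
  nonempty : M.carrier.Nonempty
  sq_norm_le : ∀ x ∈ M.carrier, ∀ v, ‖v‖ ^ 2 ≤ M.sqNorm x v
  exists_sqNorm_le : ∃ C : ℝ, ∀ a ∈ M.carrier, ∀ b ∈ M.carrier, ∀ t ∈ Ioo (0 : ℝ) 1,
    M.sqNorm (a + t • (b - a)) (b - a) ≤ C * ‖b - a‖ * (t * (1 - t))⁻¹
  vol_lt_top : M.vol univ < ⊤
  one_le_det : ∀ x ∈ M.carrier, 1 ≤ (M.metric x).det
  sq_mul_le_det : ∀ x ∈ M.carrier, x i ^ 2 * M.metric x i i ≤ (M.metric x).det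

lemma isCurve_segment (hM : Convex ℝ M.carrier) {a b : EuclideanSpace ℝ (Fin n)}
    (ha : a ∈ M.carrier) (hb : b ∈ M.carrier) : M.IsCurve (fun t => a + t • (b - a)) a b := by
  refine ⟨⟨‖b - a‖₊, fun s _ t _ => ?_⟩, fun t ht => ?_, by simp, by simp⟩
  · rw [edist_add_left, edist_eq_enorm_sub, ← sub_smul, enorm_smul, edist_eq_enorm_sub, mul_comm]
    rfl
  · have := hM ha hb (sub_nonneg.mpr ht.2) ht.1 (by ring)
    convert! this using 1
    module

/-- The straight segment is the competitor; the singularities of its speed at both ends are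
integrable. -/
lemma riemDist_le_of_sqNorm_le (hM : Convex ℝ M.carrier) {a b : EuclideanSpace ℝ (Fin n)}
    (ha : a ∈ M.carrier) (hb : b ∈ M.carrier) {C : ℝ}
    (h : ∀ t ∈ Ioo (0 : ℝ) 1, M.sqNorm (a + t • (b - a)) (b - a) ≤ C * (t * (1 - t))⁻¹) :
    M.riemDist a b ≤ ENNReal.ofReal √C *
      ∫⁻ t in Icc (0 : ℝ) 1, ENNReal.ofReal √((t * (1 - t))⁻¹) := by
  refine (iInf₂_le (fun t : ℝ => a + t • (b - a)) (isCurve_segment hM ha hb)).trans ?_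
  rw [length, ← lintegral_const_mul' _ _ ENNReal.ofReal_ne_top,
    ← setLIntegral_congr Ioo_ae_eq_Icc, ← setLIntegral_congr Ioo_ae_eq_Icc]
  refine setLIntegral_mono' measurableSet_Ioo fun t ht => ?_
  have hd : deriv (fun t : ℝ => a + t • (b - a)) t = b - a := by
    simpa using (((hasDerivAt_id t).smul_const (b - a)).const_add a).deriv
  have h1 : 0 ≤ (t * (1 - t))⁻¹ := inv_nonneg.mpr (mul_nonneg ht.1.le (sub_nonneg.mpr ht.2.le))
  rw [hd, ← ENNReal.ofReal_mul (Real.sqrt_nonneg _), ← Real.sqrt_mul' _ h1]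
  exact ENNReal.ofReal_le_ofReal (Real.sqrt_le_sqrt (h t ht))

/-- Projecting a curve onto the direction `y - x` gives a Lipschitz, hence absolutely continuous,
real function. Its derivative is at most `‖y - x‖` times the Riemannian speed, and its increment is
`‖y - x‖²`. -/
lemma ofReal_norm_sub_le_riemDist (h : ∀ x ∈ M.carrier, ∀ v, ‖v‖ ^ 2 ≤ M.sqNorm x v)
    (x y : EuclideanSpace ℝ (Fin n)) : ENNReal.ofReal ‖y - x‖ ≤ M.riemDist x y := by
  refine le_iInf₂ fun γ hγ => ?_
  rcases eq_or_ne y x with rfl | hne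
  · simp
  have hpos : 0 < ‖y - x‖ := norm_pos_iff.mpr (sub_ne_zero.mpr hne)
  obtain ⟨K, hK⟩ := hγ.lipschitz
  set e := y - x
  set f : ℝ → ℝ := fun t => innerSL ℝ e (γ t) with hf
  have hfL : LipschitzOnWith (‖innerSL ℝ e‖₊ * K) f (uIcc 0 1) := by
    rw [uIcc_of_le zero_le_one]
    exact (innerSL ℝ e).lipschitz.comp_lipschitzOnWith hK
  have hint := hfL.absolutelyContinuousOnInterval.integral_deriv_eq_sub
  have hfe : f 1 - f 0 = ‖e‖ * ‖e‖ := by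
    simp only [hf, hγ.source, hγ.target, ← map_sub]
    rw [innerSL_apply_apply, real_inner_self_eq_norm_mul_norm]
  have hae : ∀ᵐ t ∂volume.restrict (Icc (0 : ℝ) 1),
      ‖deriv f t‖ₑ ≤ ENNReal.ofReal ‖e‖ *
        ENNReal.ofReal √(M.sqNorm (γ t) (deriv γ t)) := by
    rw [← restrict_Ioo_eq_restrict_Icc, ae_restrict_iff' measurableSet_Ioo]
    filter_upwards [hK.ae_differentiableWithinAt_of_mem_real] with t ht hmem
    have hI : Icc (0 : ℝ) 1 ∈ 𝓝 t := Icc_mem_nhds hmem.1 hmem.2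
    have hd := (ht (Ioo_subset_Icc_self hmem)).differentiableAt hI
    have hfd : deriv f t = innerSL ℝ e (deriv γ t) :=
      ((innerSL ℝ e).hasFDerivAt.comp_hasDerivAt t hd.hasDerivAt).deriv
    rw [hfd, ← ENNReal.ofReal_mul (norm_nonneg _), Real.enorm_eq_ofReal_abs]
    refine ENNReal.ofReal_le_ofReal ?_
    refine (abs_real_inner_le_norm e _).trans ?_
    gcongr
    exact Real.le_sqrt_of_sq_le (h _ (hγ.mapsTo (Ioo_subset_Icc_self hmem)) _)
  have key : ENNReal.ofReal (‖e‖ * ‖e‖) ≤ ENNReal.ofReal ‖e‖ * M.length γ := by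
    calc ENNReal.ofReal (‖e‖ * ‖e‖) = ‖∫ t in (0 : ℝ)..1, deriv f t‖ₑ := by
          rw [hint, hfe, Real.enorm_eq_ofReal (by positivity)]
      _ ≤ ∫⁻ t in Icc (0 : ℝ) 1, ‖deriv f t‖ₑ := by
          rw [intervalIntegral.integral_of_le zero_le_one, ← integral_Icc_eq_integral_Ioc]
          exact enorm_integral_le_lintegral_enorm _
      _ ≤ _ := by
          rw [length, ← lintegral_const_mul' _ _ ENNReal.ofReal_ne_top]
          exact lintegral_mono_ae hae
  rw [ENNReal.ofReal_mul (norm_nonneg _)] at key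
  exact (ENNReal.mul_le_mul_iff_right (ENNReal.ofReal_pos.mpr hpos).ne'
    ENNReal.ofReal_ne_top).mp key

/-- A sequence in the domain which converges to a point outside the domain in `ℝⁿ` converges to a
boundary point in the metric completion. -/
lemma HasReachableBoundary.exists_tendsto_boundary {i : Fin n} (hM : M.HasReachableBoundary i)
    (x : ℕ → M.Point) {z : EuclideanSpace ℝ (Fin n)} (hz : z ∉ M.carrier)
    (hx : Tendsto (fun k => (x k).1) atTop (𝓝 z)) :
    ∃ p ∈ M.boundary, Tendsto (fun k => (x k : M.Completed)) atTop (𝓝 p) := by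
  obtain ⟨C, hC⟩ := hM.exists_sqNorm_le
  set A := ∫⁻ t in Icc (0 : ℝ) 1, ENNReal.ofReal √((t * (1 - t))⁻¹)
  have hA : A ≠ ⊤ := lintegral_sqrt_inv_mul_one_sub_lt_top.ne
  -- The distance is controlled by the square root of the Euclidean one, so Euclidean Cauchy
  -- sequences in `M` are Riemannian Cauchy.
  have hdist : ∀ p q : M.Point,
      edist p q ≤ ENNReal.ofReal √(C * ‖q.1 - p.1‖) * A := fun p q =>
    riemDist_le_of_sqNorm_le hM.convex p.2 q.2 (hC _ p.2 _ q.2)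
  have hcau : CauchySeq x := by
    rw [EMetric.cauchySeq_iff]
    have hlim : Tendsto (fun p : ℕ × ℕ => ENNReal.ofReal √(C * ‖(x p.2).1 - (x p.1).1‖) * A)
        (atTop ×ˢ atTop) (𝓝 0) := by
      have h1 : Tendsto (fun p : ℕ × ℕ => (x p.2).1 - (x p.1).1) (atTop ×ˢ atTop)
          (𝓝 (z - z)) :=
        (hx.comp tendsto_snd).sub (hx.comp tendsto_fst)
      have h2 := ENNReal.Tendsto.mul_const (b := A)
        (ENNReal.tendsto_ofReal ((h1.norm.const_mul C).sqrt)) (Or.inr hA)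
      simpa using h2
    intro ε hε
    rw [prod_atTop_atTop_eq] at hlim
    obtain ⟨N, hN⟩ := (hlim.eventually_lt_const hε).exists_forall_of_atTop
    exact ⟨max N.1 N.2, fun k hk l hl => (hdist _ _).trans_lt
      (hN (k, l) ⟨(le_max_left _ _).trans hk, (le_max_right _ _).trans hl⟩)⟩
  obtain ⟨p, hp⟩ := cauchySeq_tendsto_of_complete
    ((UniformSpace.Completion.uniformContinuous_coe M.Point).comp_cauchySeq hcau)
  refine ⟨p, ?_, hp⟩
  -- A limit `y` in `M` would also be the Euclidean limit, forcing `z = y ∈ M`.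
  rintro ⟨y, rfl⟩
  have hy : Tendsto x atTop (𝓝 y) :=
    (UniformSpace.Completion.isUniformInducing_coe M.Point).isInducing.tendsto_nhds_iff.mpr hp
  rw [tendsto_iff_edist_tendsto_0] at hy
  have hyz : Tendsto (fun k => (x k).1) atTop (𝓝 y.1) := by
    rw [tendsto_iff_edist_tendsto_0]
    refine tendsto_of_tendsto_of_tendsto_of_le_of_le tendsto_const_nhds hy
      (fun _ => zero_le) fun k => ?_
    rw [edist_dist, dist_eq_norm, norm_sub_rev]
    exact ofReal_norm_sub_le_riemDist hM.sq_norm_le _ _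
  exact hz (tendsto_nhds_unique hx hyz ▸ y.2)

end RiemannianDomain

/-! ### The flux inequality and the capacity of the boundary. -/

namespace RiemannianDomain

variable {n : ℕ} {M : RiemannianDomain n} {i : Fin n}

/-- Since `∂_i u = g(e_i, grad u)`, this is Cauchy–Schwarz for the inner product `g(x)`. -/
lemma sq_fderiv_single_le {x : EuclideanSpace ℝ (Fin n)} (hx : x ∈ M.carrier) (i : Fin n)
    (u : EuclideanSpace ℝ (Fin n) → ℝ) :
    fderiv ℝ u x (EuclideanSpace.single i 1) ^ 2 ≤
      M.metric x i i * M.sqNorm x (M.grad u x) := by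
  have hG := M.posDef_metric x hx
  set G := M.metric x with hGdef
  set d : Fin n → ℝ := fun j => fderiv ℝ u x (EuclideanSpace.single j 1)
  have hw : (M.grad u x).ofLp = G⁻¹.mulVec d := rfl
  have hd : G.mulVec (M.grad u x).ofLp = d := by
    rw [hw, Matrix.mulVec_mulVec, Matrix.mul_nonsing_inv _ hG.det_pos.ne'.isUnit,
      Matrix.one_mulVec]
  have hB : ∀ v w : Fin n → ℝ, Matrix.toBilin' G v w = v ⬝ᵥ G.mulVec w :=
    fun v w => Matrix.toBilin'_apply' G v w
  have hsymm : ∀ v w : Fin n → ℝ, v ⬝ᵥ G.mulVec w = w ⬝ᵥ G.mulVec v := fun v w => by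
    have hT : G.transpose = G := hG.isHermitian
    rw [Matrix.dotProduct_mulVec, ← Matrix.mulVec_transpose, hT, dotProduct_comm]
  have hcs := (Matrix.toBilin' G).apply_mul_apply_le_of_forall_zero_le
    (fun v => by simpa [hB] using hG.posSemidef.dotProduct_mulVec_nonneg v)
    (Pi.single i 1) (M.grad u x).ofLp
  rw [hB, hB, hB, hB, hsymm (M.grad u x).ofLp, hd, single_one_dotProduct] at hcs
  have h1 : Pi.single i (1 : ℝ) ⬝ᵥ G.mulVec (Pi.single i 1) = G i i := by simp
  have h2 : (M.grad u x).ofLp ⬝ᵥ d = M.sqNorm x (M.grad u x) := by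
    rw [← hd]
    simp only [dotProduct, Matrix.mulVec, sqNorm, Finset.mul_sum]
    refine Finset.sum_congr rfl fun i _ => Finset.sum_congr rfl fun j _ => ?_
    ring
  rw [h1, h2] at hcs
  rw [sq]
  exact hcs

lemma continuousOn_sqrt_det : ContinuousOn (fun x => √(M.metric x).det) M.carrier := by
  refine ContinuousOn.sqrt ?_
  simp only [Matrix.det_apply]
  refine continuousOn_finsetSum _ fun σ _ => ContinuousOn.const_smul ?_ _
  exact continuousOn_finsetProd _ fun j _ => (M.smooth_metric _ _).continuousOn

lemma aemeasurable_density : AEMeasurable (fun x => ENNReal.ofReal √(M.metric x).det)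
    (volume.restrict M.carrier) :=
  (continuousOn_sqrt_det.aemeasurable M.isOpen_carrier.measurableSet).ennreal_ofReal

lemma lintegral_vol (g : EuclideanSpace ℝ (Fin n) → ℝ≥0∞) :
    ∫⁻ x, g x ∂M.vol = ∫⁻ x in M.carrier, ENNReal.ofReal √(M.metric x).det * g x :=
  lintegral_withDensity_eq_lintegral_mul_non_measurable₀ _ aemeasurable_density
    (ae_of_all _ fun _ => ENNReal.ofReal_lt_top) g

lemma ae_vol_mem_carrier : ∀ᵐ x ∂M.vol, x ∈ M.carrier :=
  withDensity_absolutelyContinuous _ _ (ae_restrict_mem M.isOpen_carrier.measurableSet)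

/-- Cauchy–Schwarz between the Lebesgue integral and the Riemannian `L²` norm. -/
lemma lintegral_enorm_le {f s : EuclideanSpace ℝ (Fin n) → ℝ} (hf : ContinuousOn f M.carrier)
    (hs : ∀ x ∈ M.carrier, f x ^ 2 ≤ (M.metric x).det * s x) :
    ∫⁻ x in M.carrier, ‖f x‖ₑ ≤
      M.vol univ ^ (1 / 2 : ℝ) * (∫⁻ x, ENNReal.ofReal (s x) ∂M.vol) ^ (1 / 2 : ℝ) := by
  set F : EuclideanSpace ℝ (Fin n) → ℝ := fun x => f x / √(M.metric x).det with hF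
  have hdet : ∀ x ∈ M.carrier, 0 < (M.metric x).det := fun x hx => (M.posDef_metric x hx).det_pos
  have hFc : ContinuousOn F M.carrier := hf.div continuousOn_sqrt_det fun x hx =>
    (Real.sqrt_pos.mpr (hdet x hx)).ne'
  have hFm : AEMeasurable (fun x => ‖F x‖ₑ) M.vol :=
    (((hFc.aemeasurable M.isOpen_carrier.measurableSet).mono_ac
      (withDensity_absolutelyContinuous _ _))).enorm
  -- Dividing by the density turns the Lebesgue integral into a Riemannian one, to which Hölder with
  -- the constant 1 applies.
  have h1 : ∫⁻ x in M.carrier, ‖f x‖ₑ = ∫⁻ x, 1 * ‖F x‖ₑ ∂M.vol := by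
    rw [lintegral_vol]
    refine setLIntegral_congr_fun M.isOpen_carrier.measurableSet fun x hx => ?_
    have hp := Real.sqrt_pos.mpr (hdet x hx)
    simp only [one_mul, hF]
    rw [← Real.enorm_eq_ofReal hp.le, ← enorm_mul, mul_div_cancel₀ _ hp.ne']
  rw [h1]
  refine (ENNReal.lintegral_mul_le_Lp_mul_Lq M.vol Real.HolderConjugate.two_two
    aemeasurable_const hFm).trans ?_
  simp only [ENNReal.one_rpow, lintegral_one]
  gcongr _ * ?_ ^ (1 / 2 : ℝ)
  refine lintegral_mono_ae ?_
  filter_upwards [ae_vol_mem_carrier] with x hx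
  rw [Real.enorm_eq_ofReal_abs, ENNReal.ofReal_rpow_of_nonneg (abs_nonneg _) zero_le_two]
  refine ENNReal.ofReal_le_ofReal ?_
  rw [Real.rpow_two, sq_abs, hF]
  dsimp only
  rw [div_pow, Real.sq_sqrt (hdet x hx).le, div_le_iff₀ (hdet x hx), mul_comm]
  exact hs x hx

lemma continuousOn_fderiv_single {u : EuclideanSpace ℝ (Fin n) → ℝ}
    (hu : ContDiffOn ℝ ∞ u M.carrier) (i : Fin n) :
    ContinuousOn (fun x => fderiv ℝ u x (EuclideanSpace.single i 1)) M.carrier :=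
  (hu.continuousOn_fderiv_of_isOpen M.isOpen_carrier (by simp)).clm_apply continuousOn_const

namespace HasReachableBoundary

variable (hM : M.HasReachableBoundary i)
include hM

lemma lintegral_enorm_le_L2 {u : EuclideanSpace ℝ (Fin n) → ℝ} (hu : ContinuousOn u M.carrier) :
    ∫⁻ x in M.carrier, ‖u x‖ₑ ≤
      M.vol univ ^ (1 / 2 : ℝ) * (∫⁻ x, ENNReal.ofReal (u x ^ 2) ∂M.vol) ^ (1 / 2 : ℝ) :=
  lintegral_enorm_le hu fun x hx => le_mul_of_one_le_left (sq_nonneg _) (hM.one_le_det x hx)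

lemma lintegral_enorm_mul_fderiv_le {u : EuclideanSpace ℝ (Fin n) → ℝ}
    (hu : ContDiffOn ℝ ∞ u M.carrier) :
    ∫⁻ x in M.carrier, ‖x i * fderiv ℝ u x (EuclideanSpace.single i 1)‖ₑ ≤
      M.vol univ ^ (1 / 2 : ℝ) *
        (∫⁻ x, ENNReal.ofReal (M.sqNorm x (M.grad u x)) ∂M.vol) ^ (1 / 2 : ℝ) := by
  refine lintegral_enorm_le
    (ContinuousOn.mul (by fun_prop) (continuousOn_fderiv_single hu i)) fun x hx => ?_
  have h0 : 0 ≤ M.sqNorm x (M.grad u x) :=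
    (sq_nonneg _).trans (hM.sq_norm_le x hx (M.grad u x))
  calc (x i * fderiv ℝ u x (EuclideanSpace.single i 1)) ^ 2
      = x i ^ 2 * fderiv ℝ u x (EuclideanSpace.single i 1) ^ 2 := mul_pow _ _ _
    _ ≤ x i ^ 2 * (M.metric x i i * M.sqNorm x (M.grad u x)) := by
        gcongr
        exact sq_fderiv_single_le hx i u
    _ = x i ^ 2 * M.metric x i i * M.sqNorm x (M.grad u x) := by ring
    _ ≤ _ := by
        gcongr
        exact hM.sq_mul_le_det x hx

lemma volume_carrier_lt_top : volume M.carrier < ⊤ := hM.isBounded.measure_lt_top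

lemma volume_carrier_pos : 0 < volume M.carrier := M.isOpen_carrier.measure_pos _ hM.nonempty

/-- Divergence theorem for the field `x_i ∂_i`: a function which is `1` near the boundary has
flux equal to the volume of the domain. -/
lemma volume_carrier_le {r w : EuclideanSpace ℝ (Fin n) → ℝ} (hw : w ∈ M.smoothCompact)
    (hr : ∀ x ∈ M.carrier, r x = 1 - w x) :
    volume M.carrier ≤
      ∫⁻ x in M.carrier, ‖r x + x i * fderiv ℝ r x (EuclideanSpace.single i 1)‖ₑ := by
  obtain ⟨hwd, hwc, hws⟩ := hw
  set e : EuclideanSpace ℝ (Fin n) := EuclideanSpace.single i 1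
  set g : EuclideanSpace ℝ (Fin n) → ℝ := fun x => x i * w x
  have hgd : ContDiff ℝ ∞ g := ContDiff.mul (by fun_prop) hwd
  have hgc : HasCompactSupport g := hwc.mul_left
  have hg' : ∀ x, fderiv ℝ g x e = w x + x i * fderiv ℝ w x e := fun x => by
    have h1 : HasFDerivAt (fun x : EuclideanSpace ℝ (Fin n) => x i)
      (EuclideanSpace.proj i : EuclideanSpace ℝ (Fin n) →L[ℝ] ℝ) x :=
      (EuclideanSpace.proj i : EuclideanSpace ℝ (Fin n) →L[ℝ] ℝ).hasFDerivAt
    have h2 := (hwd.differentiable (by simp) x).hasFDerivAt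
    rw [(h1.fun_mul h2).fderiv]
    simp [e, add_comm]
  have hg'c : Continuous fun x => fderiv ℝ g x e :=
    (hgd.continuous_fderiv (by simp)).clm_apply continuous_const
  have hg'i : Integrable fun x => fderiv ℝ g x e :=
    hg'c.integrable_of_hasCompactSupport (hgc.fderiv_apply (𝕜 := ℝ) e)
  -- Integration by parts against the constant function 1.
  have hzero : ∫ x, fderiv ℝ g x e = 0 := by
    have := integral_mul_fderiv_eq_neg_fderiv_mul_of_integrable (μ := volume) (𝕜 := ℝ)
      (f := fun _ : EuclideanSpace ℝ (Fin n) => (1 : ℝ)) (g := g) (v := e)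
      (by simp) (by simpa using hg'i)
      (by simpa using hgd.continuous.integrable_of_hasCompactSupport hgc)
      (fun _ _ => by fun_prop) (fun _ _ => hgd.differentiable (by simp) _)
    simpa using this
  have hset : ∫ x in M.carrier, fderiv ℝ g x e = 0 := by
    rw [← hzero]
    refine setIntegral_eq_integral_of_forall_compl_eq_zero fun x hx => ?_
    have hx' : x ∉ tsupport w := fun h => hx (hws h)
    rw [hg', image_eq_zero_of_notMem_tsupport hx', fderiv_of_notMem_tsupport ℝ hx']
    simp
  have hfin : IsFiniteMeasure (volume.restrict M.carrier) :=
    ⟨by rw [Measure.restrict_apply_univ]; exact hM.volume_carrier_lt_top⟩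
  have hint : ∫ x in M.carrier, (1 - fderiv ℝ g x e) = volume.real M.carrier := by
    rw [integral_sub (integrable_const _) hg'i.integrableOn, hset]
    simp
  -- `r` is prescribed only on the open carrier, which is enough to know its derivative there.
  have hpt : ∀ x ∈ M.carrier, 1 - fderiv ℝ g x e = r x + x i * fderiv ℝ r x e := fun x hx => by
    have hev : r =ᶠ[𝓝 x] fun y => 1 - w y := by
      filter_upwards [M.isOpen_carrier.mem_nhds hx] with y hy using hr y hy
    rw [hev.fderiv_eq, hr x hx, hg', fderiv_const_sub]
    simp only [neg_apply]
    ring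
  calc volume M.carrier = ‖∫ x in M.carrier, (1 - fderiv ℝ g x e)‖ₑ := by
        rw [hint, Real.enorm_eq_ofReal measureReal_nonneg,
          ofReal_measureReal hM.volume_carrier_lt_top.ne]
    _ ≤ ∫⁻ x in M.carrier, ‖1 - fderiv ℝ g x e‖ₑ := enorm_integral_le_lintegral_enorm _
    _ = _ := setLIntegral_congr_fun M.isOpen_carrier.measurableSet fun x hx => by
        simp only [hpt x hx]

lemma volume_carrier_le_norm12 {u w : EuclideanSpace ℝ (Fin n) → ℝ}
    (hu : ContDiffOn ℝ ∞ u M.carrier) (hw : w ∈ M.smoothCompact)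
    (huw : ∀ x ∈ M.carrier, u x = 1 - w x) :
    volume M.carrier ≤ M.vol univ ^ (1 / 2 : ℝ) * M.norm12 u := by
  refine (hM.volume_carrier_le hw huw).trans ?_
  rw [norm12, mul_add]
  refine le_trans ?_ (add_le_add (hM.lintegral_enorm_le_L2 hu.continuousOn)
    (hM.lintegral_enorm_mul_fderiv_le hu))
  rw [← lintegral_add_left']
  · exact lintegral_mono fun x => enorm_add_le _ _
  · exact (hu.continuousOn.aemeasurable M.isOpen_carrier.measurableSet).enorm

/-- A test function which is `1` near the boundary differs from `1` by a compactly supported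
function on the domain. -/
lemma indicator_one_sub_mem_smoothCompact {u : EuclideanSpace ℝ (Fin n) → ℝ}
    {v : M.Completed → ℝ} (huv : M.IsTest u v) {O : Set M.Completed} (hO : IsOpen O)
    (hbO : M.boundary ⊆ O) (hv : ∀ p ∈ O, v p = 1) :
    (M.carrier.indicator fun x => 1 - u x) ∈ M.smoothCompact := by
  set w := M.carrier.indicator fun x => 1 - u x with hw
  have hsupp : Function.support w ⊆ M.carrier := support_indicator_subset
  -- A sequence in the support of `w` with Euclidean limit outside `M` would converge to a point of
  -- `Γ` and so enter `O`, where `u = 1` and `w = 0`.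
  have hts : tsupport w ⊆ M.carrier := by
    intro z hz
    by_contra hzM
    obtain ⟨x, hxw, hxz⟩ := mem_closure_iff_seq_limit.mp hz
    let y : ℕ → M.Point := fun k => ⟨x k, hsupp (hxw k)⟩
    obtain ⟨p, hp, hyp⟩ := hM.exists_tendsto_boundary y hzM hxz
    obtain ⟨k, hk⟩ := (hyp.eventually (hO.mem_nhds (hbO hp))).exists
    have h1 : v (y k) = 1 := hv _ hk
    rw [huv.eq_restrict] at h1
    refine hxw k ?_
    rw [hw, indicator_of_mem (hsupp (hxw k)), show u (x k) = 1 from h1, sub_self]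
  refine ⟨contDiff_iff_contDiffAt.mpr fun x => ?_, ?_, hts⟩
  · by_cases hx : x ∈ tsupport w
    · have hxM := M.isOpen_carrier.mem_nhds (hts hx)
      have h1 : ContDiffAt ℝ ∞ (fun x => 1 - u x) x :=
        contDiffAt_const.sub (huv.smooth.contDiffAt hxM)
      refine h1.congr_of_eventuallyEq ?_
      filter_upwards [hxM] with y hy using indicator_of_mem hy _
    · exact contDiffAt_const.congr_of_eventuallyEq (notMem_tsupport_iff_eventuallyEq.mp hx)
  · exact Metric.isCompact_of_isClosed_isBounded (isClosed_tsupport w) (hM.isBounded.subset hts)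

theorem not_hasAlmostPolarBoundary : ¬ M.HasAlmostPolarBoundary := by
  intro h
  have hc : volume M.carrier / M.vol univ ^ (1 / 2 : ℝ) ≤ M.cap M.boundary := by
    refine le_iInf₂ fun O hO => le_iInf fun u => le_iInf fun v => le_iInf fun huv => ?_
    refine ENNReal.div_le_of_le_mul' ?_
    refine hM.volume_carrier_le_norm12 huv.1.smooth
      (hM.indicator_one_sub_mem_smoothCompact huv.1 hO.1 hO.2 huv.2.2) fun x hx => ?_
    rw [indicator_of_mem hx, sub_sub_cancel]
  rw [h, nonpos_iff_eq_zero, ENNReal.div_eq_zero_iff] at hc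
  rcases hc with hc | hc
  · exact hM.volume_carrier_pos.ne' hc
  · exact ENNReal.rpow_ne_top_of_nonneg (by norm_num) hM.vol_lt_top.ne hc

end HasReachableBoundary

/-! ### The constant 1 is not in `H¹₀`. -/

lemma exists_cutoff {K U : Set (EuclideanSpace ℝ (Fin n))} (hK : IsCompact K) (hU : IsOpen U)
    (hKU : K ⊆ U) : ∃ φ : EuclideanSpace ℝ (Fin n) → ℝ, ContDiff ℝ ∞ φ ∧ HasCompactSupport φ ∧
      tsupport φ ⊆ U ∧ (∀ x ∈ K, φ x = 1) ∧ ∀ x, φ x ∈ Icc (0 : ℝ) 1 := by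
  obtain ⟨L, hL, hKL, hLU⟩ := exists_compact_between hK hU hKU
  obtain ⟨φ, h1, h0, h01⟩ := exists_contMDiffMap_one_nhds_of_subset_interior
    (modelWithCornersSelf ℝ (EuclideanSpace ℝ (Fin n))) (n := (⊤ : ℕ∞)) hK.isClosed hKL
  have hsub : tsupport φ ⊆ L := closure_minimal
    (fun x hx => by_contra fun hxL => hx (h0 x hxL)) hL.isClosed
  exact ⟨φ, φ.contMDiff.contDiff, hL.of_isClosed_subset (isClosed_tsupport _) hsub,
    hsub.trans hLU, fun x hx => h1.self_of_nhdsSet x hx, h01⟩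

namespace HasReachableBoundary

variable (hM : M.HasReachableBoundary i)
include hM

/-- If `u` is close to `1` in `L²`, and to a fixed compactly supported function in the Dirichlet
norm, the latter distance is bounded below. -/
lemma exists_volume_carrier_le {v : EuclideanSpace ℝ (Fin n) → ℝ} (hv : v ∈ M.smoothCompact) :
    ∃ C : ℝ≥0∞, C ≠ ⊤ ∧ ∀ u ∈ M.smoothCompact, volume M.carrier ≤
      C * (∫⁻ x, ENNReal.ofReal ((u x - 1) ^ 2) ∂M.vol) ^ (1 / 2 : ℝ) +
        M.vol univ ^ (1 / 2 : ℝ) * M.norm12 (u - v) := by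
  obtain ⟨hvd, hvc, hvs⟩ := hv
  obtain ⟨φ, hφd, hφc, hφs, hφ1, hφI⟩ := exists_cutoff hvc M.isOpen_carrier hvs
  set e : EuclideanSpace ℝ (Fin n) := EuclideanSpace.single i 1
  -- `ψ = ∂_i (x_i (1 - φ))`, the coefficient of `1 - u` in `∂_i (x_i (1 - φ)(1 - u))`. It does not
  -- depend on `u`, so neither does the constant `C`.
  set ψ : EuclideanSpace ℝ (Fin n) → ℝ := fun x => 1 - φ x - x i * fderiv ℝ φ x e with hψ
  have hψc : Continuous ψ := (continuous_const.sub hφd.continuous).sub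
    (Continuous.mul (by fun_prop) ((hφd.continuous_fderiv (by simp)).clm_apply continuous_const))
  obtain ⟨C, hC⟩ := hM.isBounded.isCompact_closure.exists_bound_of_continuousOn hψc.continuousOn
  refine ⟨ENNReal.ofReal C * M.vol univ ^ (1 / 2 : ℝ), ENNReal.mul_ne_top ENNReal.ofReal_ne_top
    (ENNReal.rpow_ne_top_of_nonneg (by norm_num) hM.vol_lt_top.ne), fun u hu => ?_⟩
  obtain ⟨hud, huc, hus⟩ := hu
  -- Chosen so that `1 - w = (1 - φ)(1 - u)`.
  set w : EuclideanSpace ℝ (Fin n) → ℝ := fun x => u x - φ x * (u x - 1) with hw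
  have hwd : ContDiff ℝ ∞ w := hud.sub (hφd.mul (hud.sub contDiff_const))
  have hsupp : Function.support w ⊆ tsupport u ∪ tsupport φ := fun x hx => by
    by_contra hne
    rw [mem_union, not_or] at hne
    exact hx (by simp [hw, image_eq_zero_of_notMem_tsupport hne.1,
      image_eq_zero_of_notMem_tsupport hne.2])
  have htsupp : tsupport w ⊆ tsupport u ∪ tsupport φ :=
    closure_minimal hsupp ((isClosed_tsupport _).union (isClosed_tsupport _))
  have hwc : HasCompactSupport w :=
    (huc.isCompact.union hφc.isCompact).of_isClosed_subset (isClosed_tsupport _) htsupp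
  have hflux := hM.volume_carrier_le (r := fun x => (1 - φ x) * (1 - u x))
    ⟨hwd, hwc, htsupp.trans (union_subset hus hφs)⟩ (fun x _ => by simp only [hw]; ring)
  have hcd : ContDiffOn ℝ ∞ (u - v) M.carrier := (hud.sub hvd).contDiffOn
  have hc1 : ContinuousOn (fun x => u x - 1) M.carrier :=
    (hud.continuous.sub continuous_const).continuousOn
  have hpt : ∀ x ∈ M.carrier, ‖(1 - φ x) * (1 - u x) +
      x i * fderiv ℝ (fun x => (1 - φ x) * (1 - u x)) x e‖ₑ ≤
      ENNReal.ofReal C * ‖u x - 1‖ₑ + ‖x i * fderiv ℝ (u - v) x e‖ₑ := fun x hx => by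
    have hdφ := (hφd.differentiable (by simp) x)
    have hdu := (hud.differentiable (by simp) x)
    have hdv := (hvd.differentiable (by simp) x)
    have hder : fderiv ℝ (fun x => (1 - φ x) * (1 - u x)) x e =
        -(1 - φ x) * fderiv ℝ u x e - (1 - u x) * fderiv ℝ φ x e := by
      rw [((hdφ.hasFDerivAt.const_sub 1).fun_mul (hdu.hasFDerivAt.const_sub 1)).fderiv]
      simp
      ring
    -- As `φ = 1` on the support of `v`, the factor `1 - φ` kills `∂_i v`, so `∂_i u` may be
    -- replaced by `∂_i (u - v)`.
    have hv0 : (1 - φ x) * fderiv ℝ v x e = 0 := by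
      by_cases hxv : x ∈ tsupport v
      · rw [hφ1 x hxv, sub_self, zero_mul]
      · rw [fderiv_of_notMem_tsupport ℝ hxv]
        simp
    have hsub : fderiv ℝ (u - v) x e = fderiv ℝ u x e - fderiv ℝ v x e := by
      rw [fderiv_sub hdu hdv]
      rfl
    have heq : (1 - φ x) * (1 - u x) + x i * fderiv ℝ (fun x => (1 - φ x) * (1 - u x)) x e =
        -(ψ x * (u x - 1)) + -((1 - φ x) * (x i * fderiv ℝ (u - v) x e)) := by
      rw [hder, hsub]
      simp only [hψ]
      linear_combination (-x i) * hv0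
    rw [heq]
    refine (enorm_add_le _ _).trans ?_
    rw [enorm_neg, enorm_neg, enorm_mul, enorm_mul]
    refine add_le_add (mul_le_mul_left ?_ _) ?_
    · rw [← ofReal_norm]
      exact ENNReal.ofReal_le_ofReal (hC x (subset_closure hx))
    · refine mul_le_of_le_one_left zero_le ?_
      rw [Real.enorm_eq_ofReal (sub_nonneg.mpr (hφI x).2), ← ENNReal.ofReal_one]
      exact ENNReal.ofReal_le_ofReal (by linarith [(hφI x).1])
  refine hflux.trans ((setLIntegral_mono' M.isOpen_carrier.measurableSet hpt).trans ?_)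
  rw [lintegral_add_left' ((hc1.aemeasurable M.isOpen_carrier.measurableSet).enorm.const_mul _),
    lintegral_const_mul' _ _ ENNReal.ofReal_ne_top, mul_assoc]
  refine add_le_add (mul_le_mul_right (hM.lintegral_enorm_le_L2 hc1) _)
    ((hM.lintegral_enorm_mul_fderiv_le hcd).trans ?_)
  gcongr
  exact le_add_self

/-- Comparing `u_k` with a fixed member `u_N` of the Cauchy sequence avoids identifying the limit of
the gradients. -/
theorem H1_ne_H10 : M.H1 ≠ M.H10 := by
  have hfin : IsFiniteMeasure M.vol := ⟨hM.vol_lt_top⟩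
  have hV : M.vol univ ^ (1 / 2 : ℝ) ≠ ⊤ :=
    ENNReal.rpow_ne_top_of_nonneg (by norm_num) hM.vol_lt_top.ne
  have hmem : MemLp (fun _ : EuclideanSpace ℝ (Fin n) => (1 : ℝ)) 2 M.vol := memLp_const 1
  set f : Lp ℝ 2 M.vol := hmem.toLp _
  have hf : ⇑f =ᵐ[M.vol] fun _ => (1 : ℝ) := hmem.coeFn_toLp
  have hgrad : ∀ c x, M.sqNorm x (M.grad (fun _ => c) x) = 0 := fun c x => by
    simp [grad, sqNorm]
  have hmem1 : f ∈ M.H1 := by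
    refine ⟨fun _ _ => 1, fun _ => ⟨contDiffOn_const, ?_⟩, fun ε hε => ⟨0, fun _ _ _ _ => ?_⟩, ?_⟩
    · simpa [norm12, hgrad] using hV.lt_top
    · rw [sub_self, show (0 : EuclideanSpace ℝ (Fin n) → ℝ) = fun _ => 0 from rfl, norm12]
      simpa [hgrad] using hε
    · refine tendsto_const_nhds.congr fun k => ?_
      symm
      rw [eLpNorm_congr_ae (g := 0), eLpNorm_zero]
      filter_upwards [hf] with x hx
      simp [hx]
  intro heq
  rw [heq] at hmem1
  obtain ⟨u, hu, hcau, hlim⟩ := hmem1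
  have hlim' : Tendsto (fun k =>
      (∫⁻ x, ENNReal.ofReal ((u k x - 1) ^ 2) ∂M.vol) ^ (1 / 2 : ℝ)) atTop (𝓝 0) := by
    refine hlim.congr fun k => ?_
    have : (u k - ⇑f) =ᵐ[M.vol] fun x => u k x - 1 := by
      filter_upwards [hf] with x hx
      simp [hx]
    rw [eLpNorm_congr_ae this, eLpNorm_eq_lintegral_rpow_enorm_toReal two_ne_zero
      ENNReal.ofNat_ne_top]
    congr 1
    refine lintegral_congr fun x => ?_
    rw [Real.enorm_eq_ofReal_abs, ENNReal.toReal_ofNat,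
      ENNReal.ofReal_rpow_of_nonneg (abs_nonneg _) zero_le_two, Real.rpow_two, sq_abs]
  have hpos : 0 < volume M.carrier / 2 / (M.vol univ ^ (1 / 2 : ℝ)) :=
    ENNReal.div_pos (ENNReal.half_pos hM.volume_carrier_pos.ne').ne' hV
  obtain ⟨N, hN⟩ := hcau _ hpos
  -- `C` depends on `u N` only, so it stays fixed while `k → ∞`.
  obtain ⟨C, hC, hle⟩ := hM.exists_volume_carrier_le (hu N)
  have hbound : volume M.carrier ≤ volume M.carrier / 2 := by
    have ht : Tendsto (fun k => C *
        (∫⁻ x, ENNReal.ofReal ((u k x - 1) ^ 2) ∂M.vol) ^ (1 / 2 : ℝ) + volume M.carrier / 2)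
        atTop (𝓝 (C * 0 + volume M.carrier / 2)) :=
      (ENNReal.Tendsto.const_mul hlim' (Or.inr hC)).add_const _
    rw [mul_zero, zero_add] at ht
    refine ge_of_tendsto ht ?_
    filter_upwards [eventually_ge_atTop N] with k hk
    refine (hle (u k) (hu k)).trans ?_
    gcongr
    rw [mul_comm]
    exact ENNReal.mul_le_of_le_div (hN k hk N le_rfl).le
  exact (ENNReal.half_lt_self hM.volume_carrier_pos.ne' hM.volume_carrier_lt_top.ne).not_ge hbound

end HasReachableBoundary

end RiemannianDomain

lemma RiemannianDomain.vol_lt_top_of_sqrt_det_le {n : ℕ} {M : RiemannianDomain n}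
    {g : EuclideanSpace ℝ (Fin n) → ℝ} (hg : IntegrableOn g M.carrier)
    (h : ∀ x ∈ M.carrier, √(M.metric x).det ≤ g x) : M.vol univ < ⊤ := by
  rw [← lintegral_one, lintegral_vol]
  refine lt_of_le_of_lt (setLIntegral_mono' M.isOpen_carrier.measurableSet fun x hx => ?_)
    hg.lintegral_lt_top
  rw [mul_one]
  exact ENNReal.ofReal_le_ofReal (h x hx)

/-! ### The Baran metric of the ball. -/

section Ball

variable {n : ℕ}

lemma baranBall_carrier : (baranBall n).carrier = Metric.ball 0 1 := by
  ext x
  rw [mem_ball_zero_iff, ← sq_lt_one_iff₀ (norm_nonneg x), EuclideanSpace.real_norm_sq_eq]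
  rfl

lemma baranBall_sqNorm (x v : EuclideanSpace ℝ (Fin n)) :
    (baranBall n).sqNorm x v =
      ∑ k, v k ^ 2 + (∑ k, x k * v k) ^ 2 / (1 - ∑ k, x k ^ 2) := by
  have h : ∀ i j, (baranBall n).metric x i j * v i * v j = (if i = j then v i * v j else 0) +
      (x i * v i) * (x j * v j) / (1 - ∑ k, x k ^ 2) := fun i j => by
    simp only [baranBall, ballMatrix, Matrix.of_apply]
    split_ifs <;> ring
  simp only [RiemannianDomain.sqNorm, h, Finset.sum_add_distrib, Finset.sum_ite_eq,
    Finset.mem_univ, if_true, ← Finset.sum_div, ← Finset.mul_sum, ← Finset.sum_mul, ← sq]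

/-- The matrix is a rank-one perturbation of the identity, so the matrix determinant lemma applies.
-/
lemma baranBall_det {x : EuclideanSpace ℝ (Fin n)} (hx : x ∈ (baranBall n).carrier) :
    ((baranBall n).metric x).det = (1 - ∑ k, x k ^ 2)⁻¹ := by
  have hq : 0 < 1 - ∑ k, x k ^ 2 := sub_pos.mpr hx
  have h : (baranBall n).metric x = 1 +
      Matrix.replicateCol Unit (fun k => (1 - ∑ k, x k ^ 2)⁻¹ * x k) *
        Matrix.replicateRow Unit (fun k => x k) := by
    ext i j
    simp only [baranBall, ballMatrix, Matrix.of_apply, Matrix.add_apply, Matrix.one_apply,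
      Matrix.mul_apply, Matrix.replicateCol_apply, Matrix.replicateRow_apply,
      Finset.univ_unique, Finset.sum_singleton]
    ring
  rw [h, Matrix.det_one_add_replicateCol_mul_replicateRow]
  have : (fun k => x k) ⬝ᵥ (fun k => (1 - ∑ k, x k ^ 2)⁻¹ * x k) =
      (1 - ∑ k, x k ^ 2)⁻¹ * ∑ k, x k ^ 2 := by
    rw [dotProduct, Finset.mul_sum]
    exact Finset.sum_congr rfl fun k _ => by ring
  rw [this]
  field_simp
  ring

/-- In polar coordinates the weight `y^{n-1}` is at most 1 and `1 - y² ≥ 1 - y`, which reduces to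
one variable. -/
lemma integrableOn_inv_sqrt_one_sub_norm_sq [Nonempty (Fin n)] :
    IntegrableOn (fun x : EuclideanSpace ℝ (Fin n) => (√(1 - ‖x‖ ^ 2))⁻¹) (Metric.ball 0 1) := by
  rw [integrableOn_fun_norm_addHaar (μ := volume) (f := fun y : ℝ => (√(1 - y ^ 2))⁻¹)]
  refine Integrable.mono' integrableOn_inv_sqrt_one_sub ?_ ?_
  · exact Measurable.aestronglyMeasurable (by fun_prop)
  · rw [ae_restrict_iff' measurableSet_Ioo]
    refine ae_of_all _ fun y hy => ?_
    rw [norm_smul, Real.norm_of_nonneg (pow_nonneg hy.1.le _), Real.norm_of_nonneg (by positivity)]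
    refine (mul_le_of_le_one_left (by positivity) (pow_le_one₀ hy.1.le hy.2.le)).trans ?_
    have h1 : 0 < 1 - y := sub_pos.mpr hy.2
    refine inv_anti₀ (Real.sqrt_pos.mpr h1) (Real.sqrt_le_sqrt ?_)
    nlinarith [hy.1, hy.2]

/-- Along the segment `Q = 1 - |x|²` equals its linear interpolation plus `t(1-t)‖v‖²`, so `Q ≥
t(1-t)(D + ‖v‖²)` with `D` the absolute difference of its end values. The numerator `(x·v)²` is
`(Q'/2)²`, and `|Q'| ≤ D + ‖v‖²`. The constant 4 is not sharp. -/
lemma baranBall_sqNorm_segment_le {a b : EuclideanSpace ℝ (Fin n)}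
    (ha : a ∈ (baranBall n).carrier) (hb : b ∈ (baranBall n).carrier) {t : ℝ}
    (ht : t ∈ Ioo (0 : ℝ) 1) :
    (baranBall n).sqNorm (a + t • (b - a)) (b - a) ≤ 4 * ‖b - a‖ * (t * (1 - t))⁻¹ := by
  have hna : ‖a‖ < 1 := by rwa [baranBall_carrier, mem_ball_zero_iff] at ha
  have hnb : ‖b‖ < 1 := by rwa [baranBall_carrier, mem_ball_zero_iff] at hb
  have hb' : b = a + (b - a) := by abel
  set v := b - a with hv
  have hinner : ∀ x y : EuclideanSpace ℝ (Fin n), ∑ k, x k * y k = inner ℝ x y := fun x y => by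
    rw [PiLp.inner_apply]
    exact Finset.sum_congr rfl fun k _ => by simp [mul_comm]
  rw [baranBall_sqNorm, hinner, ← EuclideanSpace.real_norm_sq_eq,
    ← EuclideanSpace.real_norm_sq_eq, norm_add_sq_real, inner_add_left, real_inner_smul_left,
    real_inner_smul_right, real_inner_self_eq_norm_sq, norm_smul, Real.norm_of_nonneg ht.1.le]
  have hbs : ‖b‖ ^ 2 = ‖a‖ ^ 2 + 2 * inner ℝ a v + ‖v‖ ^ 2 := by
    rw [hb', norm_add_sq_real]
  have hqa : 0 ≤ 1 - ‖a‖ ^ 2 := by nlinarith [norm_nonneg a]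
  have hqb : 0 ≤ 1 - ‖b‖ ^ 2 := by nlinarith [norm_nonneg b]
  have hT : 0 < t * (1 - t) := mul_pos ht.1 (sub_pos.mpr ht.2)
  have hT4 : t * (1 - t) ≤ 1 / 4 := by nlinarith [sq_nonneg (t - 1 / 2)]
  have hint := mul_abs_sub_le_interpolation hqa hqb ht
  set P : ℝ := inner ℝ a v
  set Q : ℝ := 1 - (‖a‖ ^ 2 + 2 * (t * P) + (t * ‖v‖) ^ 2) with hQ
  set D : ℝ := |1 - ‖b‖ ^ 2 - (1 - ‖a‖ ^ 2)| with hD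
  have hDP : D = |2 * P + ‖v‖ ^ 2| := by
    rw [hD, ← abs_neg, hbs]
    congr 1
    ring
  have hQge : t * (1 - t) * (D + ‖v‖ ^ 2) ≤ Q := by
    rw [hbs] at hint
    nlinarith
  have hv2 : ‖v‖ ≤ 2 := by
    refine (norm_sub_le b a).trans (by linarith)
  have hDv : D ≤ 2 * ‖v‖ := by
    have h1 : |‖b‖ - ‖a‖| ≤ ‖v‖ := abs_norm_sub_norm_le b a
    have h2 : D = |‖b‖ - ‖a‖| * (‖b‖ + ‖a‖) := by
      rw [hD, show 1 - ‖b‖ ^ 2 - (1 - ‖a‖ ^ 2) = -((‖b‖ - ‖a‖) * (‖b‖ + ‖a‖)) by ring, abs_neg,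
        abs_mul, abs_of_nonneg (add_nonneg (norm_nonneg b) (norm_nonneg a))]
    rw [h2]
    nlinarith [abs_nonneg (‖b‖ - ‖a‖), norm_nonneg a, norm_nonneg b, norm_nonneg v]
  have hD0 : 0 ≤ D := abs_nonneg _
  have hxv : (P + t * ‖v‖ ^ 2) ^ 2 ≤ ((D + ‖v‖ ^ 2) / 2) ^ 2 := by
    rw [sq_le_sq, abs_of_nonneg (show 0 ≤ (D + ‖v‖ ^ 2) / 2 by positivity), abs_le, hDP]
    have h1 := le_abs_self (2 * P + ‖v‖ ^ 2)
    have h2 := neg_abs_le (2 * P + ‖v‖ ^ 2)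
    have h3 := mul_nonneg ht.1.le (sq_nonneg ‖v‖)
    have h4 := mul_nonneg (sub_nonneg.mpr ht.2.le) (sq_nonneg ‖v‖)
    constructor <;> nlinarith
  have hfrac : (P + t * ‖v‖ ^ 2) ^ 2 / Q ≤ (D + ‖v‖ ^ 2) / 4 * (t * (1 - t))⁻¹ := by
    have hW : 0 ≤ D + ‖v‖ ^ 2 := by positivity
    have hQ0 : 0 ≤ Q := le_trans (by positivity) hQge
    refine div_le_of_le_mul₀ hQ0 (by positivity) (hxv.trans ?_)
    rw [mul_assoc, ← div_eq_inv_mul]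
    have : D + ‖v‖ ^ 2 ≤ Q / (t * (1 - t)) := by
      rw [le_div_iff₀ hT]
      linarith
    nlinarith
  have hV : ‖v‖ ^ 2 ≤ ‖v‖ ^ 2 / 4 * (t * (1 - t))⁻¹ := by
    rw [← div_eq_mul_inv, le_div_iff₀ hT]
    nlinarith [sq_nonneg ‖v‖]
  have hI : 0 < (t * (1 - t))⁻¹ := inv_pos.mpr hT
  have hfin : ‖v‖ ^ 2 / 4 + (D + ‖v‖ ^ 2) / 4 ≤ 4 * ‖v‖ := by
    nlinarith [norm_nonneg v]
  nlinarith [mul_le_mul_of_nonneg_right hfin hI.le]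

lemma baranBall_hasReachableBoundary (i : Fin n) : (baranBall n).HasReachableBoundary i where
  convex := baranBall_carrier (n := n) ▸ convex_ball 0 1
  isBounded := baranBall_carrier (n := n) ▸ Metric.isBounded_ball
  nonempty := ⟨0, by simp [baranBall]⟩
  sq_norm_le x hx v := by
    rw [baranBall_sqNorm, EuclideanSpace.real_norm_sq_eq]
    exact le_add_of_nonneg_right (div_nonneg (sq_nonneg _) (sub_pos.mpr hx).le)
  exists_sqNorm_le := ⟨4, fun _ ha _ hb _ ht => baranBall_sqNorm_segment_le ha hb ht⟩
  vol_lt_top := by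
    have : Nonempty (Fin n) := ⟨i⟩
    refine RiemannianDomain.vol_lt_top_of_sqrt_det_le
      (g := fun x => (√(1 - ‖x‖ ^ 2))⁻¹) ?_ fun x hx => ?_
    · rw [baranBall_carrier]
      exact integrableOn_inv_sqrt_one_sub_norm_sq
    · rw [baranBall_det hx, Real.sqrt_inv, EuclideanSpace.real_norm_sq_eq]
  one_le_det x hx := by
    rw [baranBall_det hx]
    exact (one_le_inv₀ (sub_pos.mpr hx)).mpr
      (sub_le_self _ (Finset.sum_nonneg fun k _ => sq_nonneg _))
  sq_mul_le_det x hx := by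
    have hq : 0 < 1 - ∑ k, x k ^ 2 := sub_pos.mpr hx
    have hi : x i ^ 2 ≤ ∑ k, x k ^ 2 :=
      Finset.single_le_sum (f := fun k => x k ^ 2) (fun k _ => sq_nonneg _) (Finset.mem_univ i)
    rw [baranBall_det hx]
    simp only [baranBall, ballMatrix, Matrix.of_apply, if_true]
    -- After clearing denominators the claim is `x_i² (1 - |x|² + x_i²) ≤ 1`, where both factors are
    -- at most 1.
    rw [inv_eq_one_div, le_div_iff₀ hq, mul_assoc, add_mul, div_mul_cancel₀ _ hq.ne']
    nlinarith [sq_nonneg (x i)]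

end Ball

/-! ### The Baran metric of the simplex. -/

section Simplex

variable {n : ℕ}

lemma baranSimplex_lt_one {x : EuclideanSpace ℝ (Fin n)} (hx : x ∈ (baranSimplex n).carrier)
    (i : Fin n) : x i < 1 :=
  (Finset.single_le_sum (f := fun k => x k) (fun k _ => (hx.1 k).le) (Finset.mem_univ i)).trans_lt
    hx.2

lemma baranSimplex_sqNorm (x v : EuclideanSpace ℝ (Fin n)) :
    (baranSimplex n).sqNorm x v =
      ∑ k, v k ^ 2 / x k + (∑ k, v k) ^ 2 / (1 - ∑ k, x k) := by
  have h : ∀ i j, (baranSimplex n).metric x i j * v i * v j =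
      (if i = j then v i * v j / x i else 0) + v i * v j / (1 - ∑ k, x k) := fun i j => by
    simp only [baranSimplex, simplexMatrix, Matrix.of_apply]
    split_ifs <;> ring
  simp only [RiemannianDomain.sqNorm, h, Finset.sum_add_distrib, Finset.sum_ite_eq,
    Finset.mem_univ, if_true, ← Finset.sum_div, ← Finset.mul_sum, ← Finset.sum_mul, ← sq]

/-- Factoring out the diagonal part leaves a rank-one perturbation of the identity. -/
lemma baranSimplex_det {x : EuclideanSpace ℝ (Fin n)} (hx : x ∈ (baranSimplex n).carrier) :
    ((baranSimplex n).metric x).det = (∏ k, (x k)⁻¹) * (1 - ∑ k, x k)⁻¹ := by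
  have hq : 0 < 1 - ∑ k, x k := sub_pos.mpr hx.2
  have h : (baranSimplex n).metric x = Matrix.diagonal (fun k => (x k)⁻¹) * (1 +
      Matrix.replicateCol Unit (fun k => (1 - ∑ k, x k)⁻¹ * x k) *
        Matrix.replicateRow Unit (fun _ => (1 : ℝ))) := by
    ext i j
    have hi := (hx.1 i).ne'
    rw [Matrix.diagonal_mul]
    simp only [baranSimplex, simplexMatrix, Matrix.of_apply, Matrix.add_apply, Matrix.one_apply,
      Matrix.mul_apply, Matrix.replicateCol_apply, Matrix.replicateRow_apply,
      Finset.univ_unique, Finset.sum_singleton]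
    split_ifs
    · field_simp
    · field_simp
      ring
  rw [h, Matrix.det_mul, Matrix.det_diagonal, Matrix.det_one_add_replicateCol_mul_replicateRow]
  congr 1
  have : (fun _ => (1 : ℝ)) ⬝ᵥ (fun k => (1 - ∑ k, x k)⁻¹ * x k) =
      (1 - ∑ k, x k)⁻¹ * ∑ k, x k := by
    simp [dotProduct, Finset.mul_sum]
  rw [this]
  field_simp
  ring

lemma baranSimplex_carrier_subset_ball : (baranSimplex n).carrier ⊆ Metric.ball 0 1 := by
  intro x hx
  rw [mem_ball_zero_iff, ← sq_lt_one_iff₀ (norm_nonneg x), EuclideanSpace.real_norm_sq_eq]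
  refine (Finset.sum_le_sum fun k _ => ?_).trans_lt hx.2
  nlinarith [hx.1 k, baranSimplex_lt_one hx k]

/-- The squared norm is the sum of `(λ')²/λ` over the `n + 1` barycentric coordinates `λ`, each
affine along the segment, and `key` treats each one. The first `n` terms together, and the last term
alone, each cost at most `n ‖b - a‖`. -/
lemma baranSimplex_sqNorm_segment_le {a b : EuclideanSpace ℝ (Fin n)}
    (ha : a ∈ (baranSimplex n).carrier) (hb : b ∈ (baranSimplex n).carrier) {t : ℝ}
    (ht : t ∈ Ioo (0 : ℝ) 1) :
    (baranSimplex n).sqNorm (a + t • (b - a)) (b - a) ≤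
      (2 * n : ℝ) * ‖b - a‖ * (t * (1 - t))⁻¹ := by
  have hT : 0 < t * (1 - t) := mul_pos ht.1 (sub_pos.mpr ht.2)
  have key : ∀ α β : ℝ, 0 ≤ α → 0 ≤ β →
      (β - α) ^ 2 / (α + t * (β - α)) ≤ |β - α| * (t * (1 - t))⁻¹ := fun α β hα hβ => by
    have h := mul_abs_sub_le_interpolation hα hβ ht
    refine div_le_of_le_mul₀ (le_trans (by positivity) h) (by positivity) ?_
    rw [mul_assoc, ← div_eq_inv_mul, ← sq_abs, sq]
    refine mul_le_mul_of_nonneg_left ?_ (abs_nonneg _)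
    rw [le_div_iff₀ hT]
    linarith
  have habs : ∑ k, |b k - a k| ≤ n * ‖b - a‖ := by
    refine (Finset.sum_le_card_nsmul _ _ ‖b - a‖ fun k _ => ?_).trans (by simp)
    exact PiLp.norm_apply_le (b - a) k
  have h0 := key (1 - ∑ k, a k) (1 - ∑ k, b k) (sub_pos.mpr ha.2).le (sub_pos.mpr hb.2).le
  have e1 : (∑ k, (b - a) k) ^ 2 / (1 - ∑ k, (a + t • (b - a)) k) ≤
      (∑ k, |b k - a k|) * (t * (1 - t))⁻¹ := by
    have e2 : 1 - ∑ k, b k - (1 - ∑ k, a k) = -∑ k, (b k - a k) := by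
      rw [Finset.sum_sub_distrib]
      ring
    rw [e2, neg_sq, abs_neg] at h0
    have e3 : 1 - ∑ k, (a + t • (b - a)) k = 1 - ∑ k, a k + t * -∑ k, (b k - a k) := by
      simp only [PiLp.add_apply, PiLp.smul_apply, PiLp.sub_apply, smul_eq_mul,
        Finset.sum_add_distrib, ← Finset.mul_sum]
      ring
    rw [e3]
    refine h0.trans (mul_le_mul_of_nonneg_right (Finset.abs_sum_le_sum_abs _ _) ?_)
    exact (inv_pos.mpr hT).le
  have e4 : ∑ k, (b - a) k ^ 2 / (a + t • (b - a)) k ≤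
      (∑ k, |b k - a k|) * (t * (1 - t))⁻¹ := by
    rw [Finset.sum_mul]
    exact Finset.sum_le_sum fun k _ => key (a k) (b k) (ha.1 k).le (hb.1 k).le
  rw [baranSimplex_sqNorm]
  refine (add_le_add e4 e1).trans ?_
  rw [← add_mul]
  refine mul_le_mul_of_nonneg_right ?_ (inv_pos.mpr hT).le
  linarith

/-- The affine involution of `ℝⁿ` exchanging the barycentric coordinate `1 - ∑ x_k` with `x_j`. -/
noncomputable def barycentricSwap (j : Fin n) (x : EuclideanSpace ℝ (Fin n)) :
    EuclideanSpace ℝ (Fin n) :=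
  x - (∑ k, x k + x j) • EuclideanSpace.single j 1 + EuclideanSpace.single j 1

lemma barycentricSwap_apply (j k : Fin n) (x : EuclideanSpace ℝ (Fin n)) :
    barycentricSwap j x k = if k = j then 1 - ∑ l, x l else x k := by
  by_cases h : k = j
  · subst h
    simp [barycentricSwap]
    ring
  · simp [barycentricSwap, h]

/-- The linear part is `x ↦ x - f(x) e_j` with `f(e_j) = 2`, an involution, so its determinant is
`±1`. -/
lemma measurePreserving_barycentricSwap (j : Fin n) :
    MeasurePreserving (barycentricSwap j) := by
  let f : EuclideanSpace ℝ (Fin n) →ₗ[ℝ] ℝ :=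
    ∑ k, (EuclideanSpace.proj k : EuclideanSpace ℝ (Fin n) →L[ℝ] ℝ).toLinearMap +
      (EuclideanSpace.proj j : EuclideanSpace ℝ (Fin n) →L[ℝ] ℝ).toLinearMap
  have hf : ∀ x, f x = ∑ k, x k + x j := fun x => by simp [f, LinearMap.sum_apply]
  let L : EuclideanSpace ℝ (Fin n) →ₗ[ℝ] EuclideanSpace ℝ (Fin n) :=
    LinearMap.id - f.smulRight (EuclideanSpace.single j 1)
  have hL : ∀ x, L x = x - f x • EuclideanSpace.single j 1 := fun x => rfl
  have hfe : f (EuclideanSpace.single j 1) = 2 := by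
    rw [hf]
    simp [PiLp.single_apply]
    norm_num
  have hLL : L ∘ₗ L = LinearMap.id := by
    refine LinearMap.ext fun x => ?_
    rw [LinearMap.comp_apply, hL, hL, map_sub, map_smul, hfe, LinearMap.id_apply, smul_eq_mul]
    module
  have hdet : LinearMap.det L * LinearMap.det L = 1 := by
    rw [← LinearMap.det_comp, hLL, LinearMap.det_id]
  have hne : LinearMap.det L ≠ 0 := fun h => by simp [h] at hdet
  have habs : |(LinearMap.det L)⁻¹| = 1 := by
    rcases mul_self_eq_one_iff.mp hdet with h | h <;> simp [h]
  have hLmp : MeasurePreserving L := by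
    refine ⟨L.continuous_of_finiteDimensional.measurable, ?_⟩
    rw [Measure.map_linearMap_addHaar_eq_smul_addHaar _ hne, habs]
    simp
  refine ((measurePreserving_add_right volume (EuclideanSpace.single j (1 : ℝ))).comp
    hLmp).congr ?_ ?_
  · exact Continuous.measurable (by unfold barycentricSwap; fun_prop)
  exact ae_of_all _ fun x => by simp [barycentricSwap, hL, hf]

lemma Real.sqrt_sum_le {ι : Type*} (s : Finset ι) {f : ι → ℝ} (hf : ∀ k, 0 ≤ f k) :
    √(∑ k ∈ s, f k) ≤ ∑ k ∈ s, √(f k) := by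
  classical
  induction s using Finset.induction_on with
  | empty => simp
  | insert a s ha ih =>
    rw [Finset.sum_insert ha, Finset.sum_insert ha]
    exact (Real.sqrt_add_le_sqrt_add_sqrt (hf a) (Finset.sum_nonneg fun k _ => hf k)).trans
      (by gcongr)

lemma integrable_prod_indicator_inv_sqrt :
    Integrable fun x : EuclideanSpace ℝ (Fin n) =>
      ∏ k, (Ioo (0 : ℝ) 1).indicator (fun t => (√t)⁻¹) (x k) := by
  have h1 : Integrable ((Ioo (0 : ℝ) 1).indicator fun t => (√t)⁻¹) :=
    (integrable_indicator_iff measurableSet_Ioo).mpr integrableOn_inv_sqrt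
  have h2 := Integrable.fintype_prod (ι := Fin n) (𝕜 := ℝ) (fun _ => h1)
  exact (PiLp.volume_preserving_ofLp (Fin n)).integrable_comp_of_integrable h2

lemma barycentricSwap_mem {x : EuclideanSpace ℝ (Fin n)} (hx : x ∈ (baranSimplex n).carrier)
    (j k : Fin n) : barycentricSwap j x k ∈ Ioo (0 : ℝ) 1 := by
  have hpos : 0 < ∑ l, x l := (hx.1 j).trans_le
    (Finset.single_le_sum (f := fun k => x k) (fun k _ => (hx.1 k).le) (Finset.mem_univ j))
  rw [barycentricSwap_apply]
  split_ifs
  · exact ⟨sub_pos.mpr hx.2, by linarith⟩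
  · exact ⟨hx.1 k, baranSimplex_lt_one hx k⟩

lemma prod_inv_barycentricSwap {x : EuclideanSpace ℝ (Fin n)}
    (hx : x ∈ (baranSimplex n).carrier) (j : Fin n) :
    ∏ k, (barycentricSwap j x k)⁻¹ = x j * ((∏ k, (x k)⁻¹) * (1 - ∑ k, x k)⁻¹) := by
  rw [← Finset.mul_prod_erase _ _ (Finset.mem_univ j),
    ← Finset.mul_prod_erase _ (fun k => (x k)⁻¹) (Finset.mem_univ j), barycentricSwap_apply,
    if_pos rfl]
  have : ∏ k ∈ Finset.univ.erase j, (barycentricSwap j x k)⁻¹ =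
      ∏ k ∈ Finset.univ.erase j, (x k)⁻¹ :=
    Finset.prod_congr rfl fun k hk => by
      rw [barycentricSwap_apply, if_neg (Finset.ne_of_mem_erase hk)]
  have hj := (hx.1 j).ne'
  rw [this]
  field_simp

/-- The determinant is singular in `n + 1` barycentric coordinates, one more than there are
variables. As these sum to 1, it splits into `n + 1` terms, each omitting one coordinate. By
subadditivity of the square root and a measure-preserving swap, each term reduces to an integrable
product of one-variable functions. -/
lemma baranSimplex_vol_lt_top : (baranSimplex n).vol univ < ⊤ := by
  set H : EuclideanSpace ℝ (Fin n) → ℝ := fun x =>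
    ∏ k, (Ioo (0 : ℝ) 1).indicator (fun t => (√t)⁻¹) (x k) with hH
  have hHi : Integrable H := integrable_prod_indicator_inv_sqrt
  have hHe : ∀ y : EuclideanSpace ℝ (Fin n), (∀ k, y k ∈ Ioo (0 : ℝ) 1) →
      H y = √(∏ k, (y k)⁻¹) := fun y hy => by
    rw [Real.sqrt_prod _ fun k _ => (inv_pos.mpr (hy k).1).le]
    exact Finset.prod_congr rfl fun k _ => by rw [indicator_of_mem (hy k), Real.sqrt_inv]
  refine RiemannianDomain.vol_lt_top_of_sqrt_det_le
    (g := fun x => H x + ∑ j, H (barycentricSwap j x)) ?_ fun x hx => ?_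
  · refine (hHi.add (integrable_finsetSum _ fun j _ => ?_)).integrableOn
    exact (measurePreserving_barycentricSwap j).integrable_comp_of_integrable hHi
  · have hq : 0 < 1 - ∑ k, x k := sub_pos.mpr hx.2
    have hsplit : (∏ k, (x k)⁻¹) * (1 - ∑ k, x k)⁻¹ =
        ∏ k, (x k)⁻¹ + ∑ j, ∏ k, (barycentricSwap j x k)⁻¹ := by
      simp only [prod_inv_barycentricSwap hx, ← Finset.sum_mul]
      field_simp
      ring
    rw [baranSimplex_det hx, hsplit, hHe x fun k => ⟨hx.1 k, baranSimplex_lt_one hx k⟩]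
    have hnn : ∀ j, 0 ≤ ∏ k, (barycentricSwap j x k)⁻¹ := fun j =>
      Finset.prod_nonneg fun k _ => inv_nonneg.mpr (barycentricSwap_mem hx j k).1.le
    refine (Real.sqrt_add_le_sqrt_add_sqrt (Finset.prod_nonneg fun k _ =>
      inv_nonneg.mpr (hx.1 k).le) (Finset.sum_nonneg fun j _ => hnn j)).trans
      (add_le_add le_rfl ?_)
    refine (Real.sqrt_sum_le _ hnn).trans (Finset.sum_le_sum fun j _ => ?_)
    rw [hHe _ (barycentricSwap_mem hx j)]

lemma baranSimplex_hasReachableBoundary (i : Fin n) :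
    (baranSimplex n).HasReachableBoundary i where
  convex a ha b hb s t hs ht hst := by
    have hs' : s = 1 - t := by linarith
    refine ⟨fun k => ?_, ?_⟩
    · have h1 := ha.1 k
      have h2 := hb.1 k
      simp only [PiLp.add_apply, PiLp.smul_apply, smul_eq_mul]
      rcases hs.eq_or_lt with h | h
      · rw [← h, show t = 1 by linarith]
        linarith
      · nlinarith [mul_pos h h1, mul_nonneg ht h2.le]
    · have h1 := ha.2
      have h2 := hb.2
      simp only [PiLp.add_apply, PiLp.smul_apply, smul_eq_mul, Finset.sum_add_distrib,
        ← Finset.mul_sum]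
      rcases hs.eq_or_lt with h | h
      · rw [← h, show t = 1 by linarith]
        linarith
      · nlinarith
  isBounded := Metric.isBounded_ball.subset baranSimplex_carrier_subset_ball
  nonempty := by
    refine ⟨WithLp.toLp 2 fun _ => ((n : ℝ) + 1)⁻¹, fun k => ?_, ?_⟩
    · change (0 : ℝ) < ((n : ℝ) + 1)⁻¹
      positivity
    · simp only [Finset.sum_const, Finset.card_univ, Fintype.card_fin, nsmul_eq_mul]
      rw [← div_eq_mul_inv, div_lt_one (by positivity)]
      linarith
  sq_norm_le x hx v := by
    rw [baranSimplex_sqNorm, EuclideanSpace.real_norm_sq_eq]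
    refine le_add_of_le_of_nonneg (Finset.sum_le_sum fun k _ => ?_)
      (div_nonneg (sq_nonneg _) (sub_pos.mpr hx.2).le)
    exact le_div_self (sq_nonneg _) (hx.1 k) (baranSimplex_lt_one hx k).le
  exists_sqNorm_le := ⟨_, fun _ ha _ hb _ ht => baranSimplex_sqNorm_segment_le ha hb ht⟩
  vol_lt_top := baranSimplex_vol_lt_top
  one_le_det x hx := by
    rw [baranSimplex_det hx]
    refine one_le_mul_of_one_le_of_one_le (Finset.one_le_prod fun k _ => ?_) ?_
    · exact (one_le_inv₀ (hx.1 k)).mpr (baranSimplex_lt_one hx k).le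
    · exact (one_le_inv₀ (sub_pos.mpr hx.2)).mpr
        (sub_le_self _ (Finset.sum_nonneg fun k _ => (hx.1 k).le))
  sq_mul_le_det x hx := by
    have hq : 0 < 1 - ∑ k, x k := sub_pos.mpr hx.2
    have hxi := hx.1 i
    have hi : x i ≤ ∑ k, x k :=
      Finset.single_le_sum (f := fun k => x k) (fun k _ => (hx.1 k).le) (Finset.mem_univ i)
    have hprod : 1 ≤ ∏ k, (x k)⁻¹ := Finset.one_le_prod fun k _ =>
      (one_le_inv₀ (hx.1 k)).mpr (baranSimplex_lt_one hx k).le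
    rw [baranSimplex_det hx]
    refine le_trans ?_ (le_mul_of_one_le_left (inv_pos.mpr hq).le hprod)
    simp only [baranSimplex, simplexMatrix, Matrix.of_apply, if_true]
    -- What remains beside `(1 - ∑ x_k)⁻¹` is a product of two factors in `[0, 1]`, because `x_i ≤ ∑
    -- x_k`.
    have e : x i ^ 2 * ((x i)⁻¹ + 1 / (1 - ∑ k, x k)) =
        x i * (1 - ∑ k, x k + x i) * (1 - ∑ k, x k)⁻¹ := by
      field_simp
    rw [e]
    refine mul_le_of_le_one_left (inv_pos.mpr hq).le ?_
    exact mul_le_one₀ (baranSimplex_lt_one hx i).le (by linarith) (by linarith)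

end Simplex

theorem proposition2p2 (n : ℕ) (hn : 1 ≤ n) :
    ¬ (baranBall n).HasAlmostPolarBoundary ∧
    ¬ (baranSimplex n).HasAlmostPolarBoundary ∧
    (baranBall n).H1 ≠ (baranBall n).H10 ∧
    (baranSimplex n).H1 ≠ (baranSimplex n).H10 := by
  have hB := baranBall_hasReachableBoundary (⟨0, hn⟩ : Fin n)
  have hS := baranSimplex_hasReachableBoundary (⟨0, hn⟩ : Fin n)
  exact ⟨hB.not_hasAlmostPolarBoundary, hS.not_hasAlmostPolarBoundary, hB.H1_ne_H10,
    hS.H1_ne_H10⟩
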